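/- **Setting.** Let $G$ be a (finite-dimensional) Lie group acting from the left on an analytic manifold $M$ (both second countable and Hausdorff), such that $g\mapsto g\cdot x$ and $x\mapsto g\cdot x$ are analytic for all $x\in M$, $g\in G$. Assume that the action is *sated*: for no $x\in M$ are there two different points $y,z\in M\setminus\{x\}$ and a sequence $(g_n)\subseteq G$ with $\lim_n g_n\cdot y=x=\lim_n g_n\cdot z$. Let $I\subseteq\mathbb R$ be an open interval and $\gamma\colon I\to M$ an analytic immersion. *Intervals* are connected subsets of $\mathbb R$ with non-empty interior; a map on an interval is analytic, an analytic immersion, an analytic embedding, or an analytic diffeomorphism, iff it is the restriction of such a map on an open interval. **Free curves.** For analytic immersions $\delta\colon D\to M$, $\delta'\colon D'\to M$, write $\delta\sim_\circ\delta'$ iff $\delta(J)=\delta'(J')$ for non-empty open intervals $J\subseteq D$, $J'\subseteq D'$ on which $\delta$, $\delta'$ are embeddings. An interval $D\subseteq I$ is *free* iff $g\cdot\gamma|_D\sim_\circ\gamma|_D$ with $g\in G$ implies $g\cdot\gamma|_D=\gamma|_D$; it is *maximal* iff it is free and not properly contained in a free interval $D'\subseteq I$; and $\gamma$ is *free* iff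 there is a free interval. Let $G_\gamma=\{g\in G: g\cdot\gamma=\gamma\}$ and $[g]:=g\,G_\gamma$. **Relations.** Let $\delta\colon[a,b]\to M$ and $\delta'\colon D'\to M$ be analytic immersions, with $D'$ a compact or half-open interval (in the latter case possibly unbounded). Write $\delta\simeq_+\delta'$ iff $\delta|_C=\delta'\circ\rho$ for some analytic diffeomorphism $\rho\colon C\to D'$ of one of the following forms: $D'=[a',b']$, $C=[a,b]$, $\rho(a)=a'$; or $D'=[a',b')$, $C=[a,j)$ for some $a<j\le b$, $\rho(a)=a'$; or $D'=(a',b']$, $C=(j,b]$ for some $a\le j<b$, $\rho(b)=b'$. Write $\delta\simeq_-\delta'$ iff the same holds with the orientation reversed: $D'=[a',b']$, $C=[a,b]$, $\rho(a)=b'$; or $D'=[a',b')$, $C=(j,b]$, $\rho(b)=a'$; or $D'=(a',b']$, $C=[a,j)$, $\rho(a)=b'$. Write $\delta\simeq\delta'$ iff $\delta\simeq_+\delta'$ or $\delta\simeq_-\delta'$. **Decompositions.** Let $\mathfrak n=\{n\in\mathbb Z\setminus\{0\}:\mathfrak n_-\le n\le\mathfrak n_+\}$ with $-\infty\le\mathfrak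 n_-<0<\mathfrak n_+\le\infty$, and let $\{a_n\}_{n\in\mathfrak n}\subseteq I$ be strictly increasing. Put $A_0=[a_{-1},a_1]$; $A_n=[a_{n-1},a_n]$ for $\mathfrak n_-<n\le-1$; $A_n=[a_n,a_{n+1}]$ for $1\le n<\mathfrak n_+$; $A_{\mathfrak n_-}=I\cap(-\infty,a_{\mathfrak n_-}]$ if $\mathfrak n_-\ne-\infty$; and $A_{\mathfrak n_+}=I\cap[a_{\mathfrak n_+},\infty)$ if $\mathfrak n_+\neq\infty$. For a compact free interval $A\subseteq I$, an *$A$-decomposition* of $\gamma$ consists of such points together with classes $\{[g_n]\}_{n\in\mathfrak n}$ such that $A_0=A$, $[g_{\pm1}]\ne[e]$, and $g_n\cdot\gamma|_A\simeq\gamma|_{A_n}$ for all $n\in\mathfrak n$. Put $h_{\pm1}=g_{\pm1}$, $h_n=g_ng_{n+1}^{-1}$ for $\mathfrak n_-\le n\le-2$, and $h_n=g_ng_{n-1}^{-1}$ for $2\le n\le\mathfrak n_+$. A compact free interval $A$ is *positive* iff $\gamma$ has an $A$-decomposition with $g_{1}\cdot\gamma|_A\simeq_+\gamma|_{A_{1}}$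 and $g_{-1}\cdot\gamma|_A\simeq_+\gamma|_{A_{-1}}$; and $\gamma$ is *positive* iff there is a positive interval. **Proposition.** Let $\gamma\colon I\to M$ be free and positive. 1. There is a class $[h]\ne[e]$ such that, for every positive $A\subseteq I$ and every $A$-decomposition $(\{a_n\}_{n\in\mathfrak n},\{[g_n]\}_{n\in\mathfrak n})$ of $\gamma$, for all $n\in\mathfrak n$ (and all choices of representatives), $$[h_n]=[h^{\operatorname{sign}(n)}],\qquad [g_n]=[h^n],\qquad h^n\cdot\gamma|_A\simeq_+\gamma|_{A_n}.$$ This class is unique: it is already determined by the first property alone, as well as by the second property alone. 2. Each $t\in I$ is contained in the interior of some compact maximal positive interval. 3. More precisely, for each positive $A\subseteq I$ and each $A$-decomposition of $\gamma$ as above: * for $\mathfrak n_-<n\le0$ and $b'$ in the interior of $A_{n-1}$, there is $b$ in the interior of $A_n$ such that $[b',b]$ is maximal and positive; * for $0\le n<\mathfrak n_+$ and $b$ in the interior of $A_{n+1}$, there is $b'$ in the interior of $A_n$ such that $[b',b]$ is maximal and positive. -/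

import Mathlib

open Set Filter Topology
open scoped ContDiff Manifold

/-! ### Intervals, analytic curves, analytic diffeomorphisms

A curve with domain `D ⊆ ℝ` is given by a function on `ℝ` together with `D`; only its values on `D`
matter. Restrictions of a curve are expressed by passing to a smaller domain. -/

/-- An interval: a connected subset of `ℝ` with non-empty interior. -/
def IsInterval (D : Set ℝ) : Prop :=
  D.OrdConnected ∧ (interior D).Nonempty

/-- An open interval, possibly unbounded. -/
def IsOpenInterval (J : Set ℝ) : Prop :=
  IsInterval J ∧ IsOpen J

section Curves

variable (E : Type*) [NormedAddCommGroup E] [NormedSpace ℝ E]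
  {M : Type*} [TopologicalSpace M] [ChartedSpace E M]

/-- `δ` is analytic and immersive on the open set `J`. -/
def IsImmersiveOnOpen (δ : ℝ → M) (J : Set ℝ) : Prop :=
  ContMDiffOn 𝓘(ℝ, ℝ) 𝓘(ℝ, E) ω δ J ∧
    ∀ t ∈ J, Function.Injective (mfderiv 𝓘(ℝ, ℝ) 𝓘(ℝ, E) δ t)

/-- `γ : D → M` is an analytic curve: it has an analytic extension to an open interval. -/
def IsAnalyticCurve (γ : ℝ → M) (D : Set ℝ) : Prop :=
  ∃ (J : Set ℝ) (δ : ℝ → M), IsOpenInterval J ∧ D ⊆ J ∧ EqOn δ γ D ∧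
    ContMDiffOn 𝓘(ℝ, ℝ) 𝓘(ℝ, E) ω δ J

/-- `γ : D → M` is an analytic immersion: it has an analytic immersive extension to an open
interval. -/
def IsAnalyticImmersion (γ : ℝ → M) (D : Set ℝ) : Prop :=
  ∃ (J : Set ℝ) (δ : ℝ → M), IsOpenInterval J ∧ D ⊆ J ∧ EqOn δ γ D ∧ IsImmersiveOnOpen E δ J

/-- `γ : D → M` is an analytic embedding: it has an analytic immersive extension to an open
interval which is a homeomorphism onto its image. -/
def IsAnalyticEmbedding (γ : ℝ → M) (D : Set ℝ) : Prop :=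
  ∃ (J : Set ℝ) (δ : ℝ → M), IsOpenInterval J ∧ D ⊆ J ∧ EqOn δ γ D ∧ IsImmersiveOnOpen E δ J ∧
    IsEmbedding (J.domRestrict δ)

/-- The curves `γ : D → M` and `γ' : D' → M` overlap: `γ(J) = γ'(J')` for non-empty open intervals
`J ⊆ D`, `J' ⊆ D'` on which `γ`, `γ'` are embeddings. -/
def Overlap (γ : ℝ → M) (D : Set ℝ) (γ' : ℝ → M) (D' : Set ℝ) : Prop :=
  ∃ J J' : Set ℝ, IsOpenInterval J ∧ IsOpenInterval J' ∧ J ⊆ D ∧ J' ⊆ D' ∧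
    IsAnalyticEmbedding E γ J ∧ IsAnalyticEmbedding E γ' J' ∧ γ '' J = γ' '' J'

end Curves

/-- `ρ : D → D'` is an analytic diffeomorphism: it is onto `D'`, and it extends to an analytic
diffeomorphism (with inverse `σ`) between open intervals. -/
def IsAnalyticDiffeo (ρ : ℝ → ℝ) (D D' : Set ℝ) : Prop :=
  ρ '' D = D' ∧
  ∃ (U V : Set ℝ) (τ σ : ℝ → ℝ), IsOpenInterval U ∧ IsOpenInterval V ∧ D ⊆ U ∧ EqOn τ ρ D ∧
    MapsTo τ U V ∧ MapsTo σ V U ∧ InvOn σ τ U V ∧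
    AnalyticOnNhd ℝ τ U ∧ AnalyticOnNhd ℝ σ V

section Relations

variable {M : Type*}

/-- `γ : D → M` and `γ' : D' → M` agree up to an analytic diffeomorphism `ρ : D → D'` with
`ρ t = t'`. -/
def RelAt (γ : ℝ → M) (D : Set ℝ) (t : ℝ) (γ' : ℝ → M) (D' : Set ℝ) (t' : ℝ) : Prop :=
  t ∈ D ∧ t' ∈ D' ∧
    ∃ ρ : ℝ → ℝ, IsAnalyticDiffeo ρ D D' ∧ ρ t = t' ∧ ∀ s ∈ D, γ s = γ' (ρ s)

/-- The relation `γ|_[a,b] ≃₊ γ'|_D'`, for `D'` an interval which is compact or half-open (and then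
possibly unbounded). Three cases, by the shape of `D'`:
* `D' = [a', b']`: all of `[a, b]` corresponds to `D'`, with `a ↦ a'`;
* `D' = [a', b')`: some initial piece `[a, j)` of `[a, b]` corresponds to `D'`, with `a ↦ a'`;
* `D' = (a', b']`: some final piece `(j, b]` of `[a, b]` corresponds to `D'`, with `b ↦ b'`.

The shape of `D'` need not be prescribed: it is forced by that of the corresponding piece. -/
def PosRel (γ : ℝ → M) (a b : ℝ) (γ' : ℝ → M) (D' : Set ℝ) : Prop :=
  (∃ a', IsLeast D' a' ∧ RelAt γ (Icc a b) a γ' D' a') ∨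
  (∃ a', IsLeast D' a' ∧ ∃ j, a < j ∧ j ≤ b ∧ RelAt γ (Ico a j) a γ' D' a') ∨
  (∃ b', IsGreatest D' b' ∧ ∃ j, a ≤ j ∧ j < b ∧ RelAt γ (Ioc j b) b γ' D' b')

/-- The relation `γ|_[a,b] ≃₋ γ'|_D'`, the orientation reversing counterpart of `PosRel`:
* `D' = [a', b']`: all of `[a, b]` corresponds to `D'`, with `a ↦ b'`;
* `D' = [a', b')`: some final piece `(j, b]` of `[a, b]` corresponds to `D'`, with `b ↦ a'`;
* `D' = (a', b']`: some initial piece `[a, j)` of `[a, b]` corresponds to `D'`, with `a ↦ b'`. -/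
def NegRel (γ : ℝ → M) (a b : ℝ) (γ' : ℝ → M) (D' : Set ℝ) : Prop :=
  (∃ b', IsGreatest D' b' ∧ RelAt γ (Icc a b) a γ' D' b') ∨
  (∃ a', IsLeast D' a' ∧ ∃ j, a ≤ j ∧ j < b ∧ RelAt γ (Ioc j b) b γ' D' a') ∨
  (∃ b', IsGreatest D' b' ∧ ∃ j, a < j ∧ j ≤ b ∧ RelAt γ (Ico a j) a γ' D' b')

/-- The relation `γ|_[a,b] ≃ γ'|_D'`. -/
def CurveRel (γ : ℝ → M) (a b : ℝ) (γ' : ℝ → M) (D' : Set ℝ) : Prop :=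
  PosRel γ a b γ' D' ∨ NegRel γ a b γ' D'

end Relations

/-! ### Decompositions of an interval -/

/-- The index set of all non-zero integers `n` with `lo ≤ n ≤ hi`, where `lo = -∞` and `hi = ∞` are
allowed. -/
def decompIndex (lo : WithBot ℤ) (hi : WithTop ℤ) : Set ℤ :=
  {n | n ≠ 0 ∧ lo ≤ (n : WithBot ℤ) ∧ (n : WithTop ℤ) ≤ hi}

/-- A decomposition of the interval `D`: a strictly increasing family of interior points
`a n`, indexed by the non-zero integers `lo ≤ n ≤ hi`, with `lo < 0 < hi`. The values of `a`
outside the index set are irrelevant. -/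
structure IntervalDecomp (D : Set ℝ) where
  lo : WithBot ℤ
  hi : WithTop ℤ
  lo_neg : lo < 0
  hi_pos : 0 < hi
  a : ℤ → ℝ
  mem_interior : ∀ n ∈ decompIndex lo hi, a n ∈ interior D
  strictMono : StrictMonoOn a (decompIndex lo hi)

namespace IntervalDecomp

variable {D : Set ℝ} (d : IntervalDecomp D)

/-- The index set of the decomposition. -/
def index : Set ℤ := decompIndex d.lo d.hi

open Classical in
/-- The pieces `A_n` for `lo ≤ n ≤ hi`, where `n = 0` is included. -/
noncomputable def piece (n : ℤ) : Set ℝ :=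
  if n = 0 then Icc (d.a (-1)) (d.a 1)
  else if n < 0 then
    if d.lo < (n : WithBot ℤ) then Icc (d.a (n - 1)) (d.a n) else D ∩ Iic (d.a n)
  else
    if (n : WithTop ℤ) < d.hi then Icc (d.a n) (d.a (n + 1)) else D ∩ Ici (d.a n)

end IntervalDecomp

/-! ### Group actions: sated actions, stabilizers, free curves -/

section Actions

variable (G : Type*) [Group G]

/-- The action is sated: for no point `x` there are two different points `y, z ≠ x` and a sequence
`g` in `G` such that both `g n • y` and `g n • z` converge to `x`. -/
def IsSatedAction (M : Type*) [TopologicalSpace M] [MulAction G M] : Prop :=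
  ∀ x y z : M, y ≠ x → z ≠ x → y ≠ z →
    ¬ ∃ g : ℕ → G, Tendsto (fun n => g n • y) atTop (𝓝 x) ∧
      Tendsto (fun n => g n • z) atTop (𝓝 x)

/-- The stabilizer `G_γ` of the curve `γ : D → M`. -/
def curveStabilizer {M : Type*} [MulAction G M] (γ : ℝ → M) (D : Set ℝ) : Subgroup G :=
  ⨅ t ∈ D, MulAction.stabilizer G (γ t)

/-- The class `[g] = g G_γ`. -/
def curveClass {G : Type*} [Group G] {M : Type*} [MulAction G M] (γ : ℝ → M) (D : Set ℝ) (g : G) :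
    G ⧸ curveStabilizer G γ D :=
  QuotientGroup.mk g

variable (E : Type*) [NormedAddCommGroup E] [NormedSpace ℝ E]
  {M : Type*} [TopologicalSpace M] [ChartedSpace E M] [MulAction G M]

/-- `γ : D → M` is a free segment: an analytic immersion such that `g • γ` overlaps `γ` only if
`g • γ = γ`. -/
def IsFreeSegment (γ : ℝ → M) (D : Set ℝ) : Prop :=
  IsAnalyticImmersion E γ D ∧
    ∀ g : G, Overlap E (fun t => g • γ t) D γ D → ∀ t ∈ D, g • γ t = γ t

/-- `γ : D → M` is free: it is analytic, and its restriction to some interval is a free segment. -/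
def IsFreeCurve (γ : ℝ → M) (D : Set ℝ) : Prop :=
  IsAnalyticCurve E γ D ∧ ∃ D' : Set ℝ, IsInterval D' ∧ D' ⊆ D ∧ IsFreeSegment G E γ D'

/-- `A ⊆ D` is a maximal interval with respect to `γ : D → M`: it is free, and not properly
contained in a free interval. -/
def IsMaximalInterval (γ : ℝ → M) (D A : Set ℝ) : Prop :=
  IsInterval A ∧ A ⊆ D ∧ IsFreeSegment G E γ A ∧
    ∀ A' : Set ℝ, IsInterval A' → A' ⊆ D → IsFreeSegment G E γ A' → A ⊆ A' → A' = A

variable {G}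

/-- `(d, g)` represents an `A`-decomposition of `γ : I → M` for the compact free interval
`A = [α, β]`; the decomposition proper consists of the points `d.a n` and the classes of the `g n`
modulo `G_γ`, for `n` in the index set. -/
def IsADecomp (γ : ℝ → M) (I : Set ℝ) (α β : ℝ) (d : IntervalDecomp I) (g : ℤ → G) : Prop :=
  IsFreeSegment G E γ (Icc α β) ∧ d.a (-1) = α ∧ d.a 1 = β ∧
  curveClass γ I (g 1) ≠ curveClass γ I 1 ∧ curveClass γ I (g (-1)) ≠ curveClass γ I 1 ∧
  ∀ n ∈ d.index, CurveRel (fun t => g n • γ t) α β γ (d.piece n)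

/-- The elements `h_n` relating neighbouring pieces: `h_{±1} = g_{±1}`, `h_n = g_n g_{n+1}⁻¹` for
`n ≤ -2`, and `h_n = g_n g_{n-1}⁻¹` for `n ≥ 2`. -/
def stepElement (g : ℤ → G) (n : ℤ) : G :=
  if n ≤ -2 then g n * (g (n + 1))⁻¹
  else if 2 ≤ n then g n * (g (n - 1))⁻¹
  else g n

variable (G)

/-- The compact interval `[α, β]` is positive with respect to `γ : I → M`: there is an
`A`-decomposition for `A = [α, β]` with `g_{±1} • γ|_A ≃₊ γ|_{A_{±1}}`. -/
def IsPositiveInterval (γ : ℝ → M) (I : Set ℝ) (α β : ℝ) : Prop :=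
  ∃ (d : IntervalDecomp I) (g : ℤ → G), IsADecomp E γ I α β d g ∧
    PosRel (fun t => g 1 • γ t) α β γ (d.piece 1) ∧
    PosRel (fun t => g (-1) • γ t) α β γ (d.piece (-1))

/-- The curve `γ : I → M` is positive: it admits a positive interval. -/
def IsPositiveCurve (γ : ℝ → M) (I : Set ℝ) : Prop :=
  ∃ α β : ℝ, IsPositiveInterval G E γ I α β

end Actions

/-!
The proof works with germs: `GermLift γ k ε t s` says that `k • γ` near `t` coincides with `γ` near
`s`, up to an analytic change of parameter of orientation `ε`. The only analysis needed is that near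
`(t, s)` the equation `γ y = k • γ x` can hold only on the graph of one analytic function
(`ImmersiveAt.exists_local_lift`). Hence germs propagate, their relation is closed
(`GermLift.of_frequently`), they compose and invert, and on a free interval they come only from the
stabilizer of `γ` (`IsFreeSegment.mem_stabilizer`).

Let `[α, β]` be positive. The translate of `γ|_[α, β]` to its right neighbour yields a germ of some
`h` that takes `α` to `β` and does not fix `γ` (`IsShift`). Then `γ` does not overlap itself within
`[α, β]` (`IsShift.eq_of_germLift_one_of_le`), since following a self-overlap to the right would
push one of its points through `β`, and `h` would carry it back. Consequently a translate of
`γ|_[α, β]` that continues `γ` on either side is unique modulo the stabilizer and keeps the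
orientation, and by induction every decomposition has `[g n] = [h ^ n]` (`IsADecomp.posRel_zpow`).

By satedness the end points of the pieces cannot accumulate in `I`, because then whole translates of
`γ|_[α, β]` would shrink to a point; so the pieces cover `I` (`IsADecomp.exists_mem_piece`). This
provides a continuous increasing coordinate on `I` in which `[α, β]` is `[0, 1]` and `h` acts by
translation by `1` (`IsDevelopment`). An overlap within a unit interval of this coordinate can be
moved to `[0, 1]` by powers of `h`; therefore unit intervals are free, and they are maximal and
positive, with the translates as pieces. Conversely a maximal interval has unit length, so another
positive interval is a unit interval and leads to the same class `[h]`.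
-/

/-! ### Analytic curves: identity theorem and local lifts -/

section AnalyticCurves

variable {E : Type*} [NormedAddCommGroup E] [NormedSpace ℝ E]
  {M : Type*} [TopologicalSpace M] [ChartedSpace E M]

variable (E) in
/-- `f` is analytic and immersive at `t`. -/
def ImmersiveAt (f : ℝ → M) (t : ℝ) : Prop :=
  ContMDiffAt 𝓘(ℝ, ℝ) 𝓘(ℝ, E) ω f t ∧
    Function.Injective (mfderiv 𝓘(ℝ, ℝ) 𝓘(ℝ, E) f t)

lemma ImmersiveAt.congr {f g : ℝ → M} {t : ℝ} (hf : ImmersiveAt E f t) (h : g =ᶠ[𝓝 t] f) :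
    ImmersiveAt E g t := by
  refine ⟨hf.1.congr_of_eventuallyEq h, ?_⟩
  have h2 := h.mfderiv_eq (I := 𝓘(ℝ, ℝ)) (I' := 𝓘(ℝ, E))
  intro x y hxy
  apply hf.2
  have h3 := h.eq_of_nhds
  rw [h2] at hxy
  exact hxy

lemma IsAnalyticImmersion.immersiveAt {f : ℝ → M} {I : Set ℝ} (hf : IsAnalyticImmersion E f I)
    (hI : IsOpen I) : ∀ t ∈ I, ImmersiveAt E f t := by
  obtain ⟨J, δ, hJ, hIJ, heq, h1, h2⟩ := hf
  intro t ht
  have h3 : ImmersiveAt E δ t :=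
    ⟨h1.contMDiffAt (hJ.2.mem_nhds (hIJ ht)), h2 t (hIJ ht)⟩
  refine h3.congr ?_
  filter_upwards [hI.mem_nhds ht] with x hx using (heq hx).symm

lemma ImmersiveAt.continuousAt {f : ℝ → M} {t : ℝ} (hf : ImmersiveAt E f t) : ContinuousAt f t :=
  hf.1.continuousAt

/-- A function that lifts one immersion through another has non-vanishing derivative. -/
lemma ImmersiveAt.deriv_lift_ne_zero {γ δ : ℝ → M} {t : ℝ} {τ : ℝ → ℝ}
    (hδ : ImmersiveAt E δ t) (hγ : ImmersiveAt E γ (τ t)) (hτ : DifferentiableAt ℝ τ t)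
    (h : ∀ᶠ x in 𝓝 t, γ (τ x) = δ x) : deriv τ t ≠ 0 := by
  intro h0
  have h1 : ImmersiveAt E (γ ∘ τ) t := hδ.congr h
  have hd : MDifferentiableAt 𝓘(ℝ, ℝ) 𝓘(ℝ, E) γ (τ t) := hγ.1.mdifferentiableAt (by simp)
  have h2 := mfderiv_comp t hd hτ.mdifferentiableAt
  have h3 : fderiv ℝ τ t = 0 := by ext; simpa using h0
  have h4 : mfderiv 𝓘(ℝ, ℝ) 𝓘(ℝ, E) (γ ∘ τ) t = 0 := by
    rw [h2, mfderiv_eq_fderiv, h3]; exact ContinuousLinearMap.comp_zero _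
  have h5 : (1 : ℝ) = 0 := by
    apply h1.2
    rw [h4]; rfl
  exact one_ne_zero h5

lemma ContMDiffAt.comp_analyticAt {γ : ℝ → M} {t : ℝ} {τ : ℝ → ℝ}
    (hγ : ContMDiffAt 𝓘(ℝ, ℝ) 𝓘(ℝ, E) ω γ (τ t)) (hτ : AnalyticAt ℝ τ t) :
    ContMDiffAt 𝓘(ℝ, ℝ) 𝓘(ℝ, E) ω (fun x => γ (τ x)) t :=
  hγ.comp t (contMDiffAt_iff_contDiffAt.2 hτ.contDiffAt)

lemma ImmersiveAt.deriv_chart_ne_zero {f : ℝ → M} {t : ℝ} (hf : ImmersiveAt E f t) :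
    deriv (fun x => extChartAt 𝓘(ℝ, E) (f t) (f x)) t ≠ 0 := by
  intro h0
  have hd : MDifferentiableAt 𝓘(ℝ, ℝ) 𝓘(ℝ, E) f t := hf.1.mdifferentiableAt (by simp)
  have h1 := hd.mfderiv
  simp only [writtenInExtChartAt, mfld_simps] at h1
  have h2 : fderiv ℝ (fun x => extChartAt 𝓘(ℝ, E) (f t) (f x)) t = 0 := by
    ext; simpa using h0
  have h3 : mfderiv 𝓘(ℝ, ℝ) 𝓘(ℝ, E) f t = 0 := by
    rw [h1]
    rw [fderivWithin_univ]
    exact h2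
  have h4 : (1 : ℝ) = 0 := by
    apply hf.2
    rw [h3]; rfl
  exact one_ne_zero h4

variable [FiniteDimensional ℝ E]

lemma ContMDiffAt.analyticAt_chart {f : ℝ → M} {t : ℝ}
    (hf : ContMDiffAt 𝓘(ℝ, ℝ) 𝓘(ℝ, E) ω f t) :
    AnalyticAt ℝ (fun x => extChartAt 𝓘(ℝ, E) (f t) (f x)) t := by
  have := FiniteDimensional.complete ℝ E
  have h := (contMDiffAt_iff_target.1 hf).2
  rw [contMDiffAt_iff_contDiffAt] at h
  exact h.analyticAt

/-- Identity theorem for germs of analytic curves. -/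
lemma ContMDiffAt.eventuallyEq_of_frequently_eq [T2Space M] {f g : ℝ → M} {t : ℝ}
    (hf : ContMDiffAt 𝓘(ℝ, ℝ) 𝓘(ℝ, E) ω f t) (hg : ContMDiffAt 𝓘(ℝ, ℝ) 𝓘(ℝ, E) ω g t)
    (h : ∃ᶠ x in 𝓝[≠] t, f x = g x) : f =ᶠ[𝓝 t] g := by
  have h0 : f t = g t := tendsto_nhds_unique_of_frequently_eq
    hf.continuousAt.continuousWithinAt hg.continuousAt.continuousWithinAt h
  have hF := hf.analyticAt_chart
  have hG := hg.analyticAt_chart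
  rw [← h0] at hG
  have h1 := (hF.frequently_eq_iff_eventually_eq hG).1 (h.mono fun x hx => by rw [hx])
  have hs : (extChartAt 𝓘(ℝ, E) (f t)).source ∈ 𝓝 (f t) := extChartAt_source_mem_nhds _
  have hs' : (extChartAt 𝓘(ℝ, E) (f t)).source ∈ 𝓝 (g t) := by rw [← h0]; exact hs
  filter_upwards [h1, hf.continuousAt hs, hg.continuousAt.preimage_mem_nhds hs'] with x hx h2 h3
  exact (extChartAt 𝓘(ℝ, E) (f t)).injOn h2 h3 hx

/-- Identity theorem for analytic curves on a connected set. -/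
lemma eventuallyEq_of_analytic_of_frequently_eq [T2Space M] {f g : ℝ → M} {U : Set ℝ}
    (hU : IsPreconnected U)
    (hf : ∀ t ∈ U, ContMDiffAt 𝓘(ℝ, ℝ) 𝓘(ℝ, E) ω f t)
    (hg : ∀ t ∈ U, ContMDiffAt 𝓘(ℝ, ℝ) 𝓘(ℝ, E) ω g t)
    {t₀ : ℝ} (ht₀ : t₀ ∈ U) (h : ∃ᶠ x in 𝓝[≠] t₀, f x = g x) : ∀ t ∈ U, f =ᶠ[𝓝 t] g := by
  have key : U ⊆ {t | f =ᶠ[𝓝 t] g} := by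
    refine hU.subset_of_closure_inter_subset (isOpen_setOfPred_eventually_nhds)
      ⟨t₀, ht₀, (hf t₀ ht₀).eventuallyEq_of_frequently_eq (hg t₀ ht₀) h⟩ ?_
    rintro t ⟨ht, htU⟩
    by_cases hmem : f =ᶠ[𝓝 t] g
    · exact hmem
    refine (hf t htU).eventuallyEq_of_frequently_eq (hg t htU) ?_
    rw [mem_closure_iff_frequently] at ht
    rw [frequently_nhdsWithin_iff]
    refine ht.mono fun x hx => ⟨Filter.EventuallyEq.eq_of_nhds hx, ?_⟩
    rintro rfl
    exact hmem hx
  exact key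

/-- Local lifting through an immersion: near `(t, s)`, the equation `γ y = δ x` can only hold
on the graph of an analytic function `ρ`. -/
lemma ImmersiveAt.exists_local_lift {γ δ : ℝ → M} {s t : ℝ} (hγ : ImmersiveAt E γ s)
    (hδ : ContMDiffAt 𝓘(ℝ, ℝ) 𝓘(ℝ, E) ω δ t) (hst : γ s = δ t) :
    ∃ ρ : ℝ → ℝ, AnalyticAt ℝ ρ t ∧ ρ t = s ∧
      ∀ᶠ p : ℝ × ℝ in 𝓝 (t, s), γ p.2 = δ p.1 → p.2 = ρ p.1 := by
  have hF := hγ.1.analyticAt_chart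
  have hF' := hγ.deriv_chart_ne_zero
  have hD := hδ.analyticAt_chart
  rw [← hst] at hD
  set c := extChartAt 𝓘(ℝ, E) (γ s)
  -- A linear functional that does not vanish on the velocity turns `γ` into a local coordinate.
  obtain ⟨l, hl⟩ := SeparatingDual.exists_ne_zero (R := ℝ) hF'
  have hφ : AnalyticAt ℝ (fun x => l (c (γ x))) s := (l.analyticAt _).fun_comp hF
  have hφ' : deriv (fun x => l (c (γ x))) s ≠ 0 := by
    have h := (l.hasFDerivAt.comp_hasDerivAt s hF.differentiableAt.hasDerivAt).deriv
    exact fun h0 => hl (h.symm.trans h0)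
  refine ⟨fun x => hφ.hasStrictDerivAt.localInverse _ _ _ hφ' (l (c (δ x))), ?_, ?_, ?_⟩
  · refine AnalyticAt.fun_comp (f := fun x => l (c (δ x))) ?_ ((l.analyticAt _).fun_comp hD)
    have := hφ.analyticAt_localInverse hφ'
    simp only [hst] at this
    simpa only [hst] using this
  · have : l (c (δ t)) = (fun x => l (c (γ x))) s := by simp [hst]
    show hφ.hasStrictDerivAt.localInverse _ _ _ hφ' (l (c (δ t))) = s
    rw [this]
    exact HasStrictFDerivAt.localInverse_apply_image ..
  · have h1 := hφ.hasStrictDerivAt.eventually_left_inverse hφ'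
    rw [nhds_prod_eq]
    filter_upwards [h1.prod_inr (𝓝 t)] with p hp heq
    rw [← heq]
    exact hp.symm

lemma ImmersiveAt.eventually_injective {γ : ℝ → M} {s : ℝ} (hγ : ImmersiveAt E γ s) :
    ∀ᶠ p : ℝ × ℝ in 𝓝 (s, s), γ p.2 = γ p.1 → p.2 = p.1 := by
  obtain ⟨ρ, hρ, hρs, h⟩ := hγ.exists_local_lift hγ.1 rfl
  have h2 : Tendsto (fun p : ℝ × ℝ => (p.1, p.1)) (𝓝 (s, s)) (𝓝 (s, s)) :=
    (continuous_fst.prodMk continuous_fst).tendsto' _ _ rfl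
  filter_upwards [h, h2.eventually h] with p h3 h4 h5
  rw [h3 h5, ← h4 rfl]

lemma ImmersiveAt.exists_injOn {γ : ℝ → M} {s : ℝ} (hγ : ImmersiveAt E γ s) :
    ∃ ε > 0, InjOn γ (Ioo (s - ε) (s + ε)) := by
  have h := hγ.eventually_injective
  rw [nhds_prod_eq, eventually_prod_self_iff (r := fun x y => γ y = γ x → y = x)] at h
  obtain ⟨W, hW, h⟩ := h
  obtain ⟨ε, hε, hb⟩ := Metric.mem_nhds_iff.1 hW
  rw [Real.ball_eq_Ioo] at hb
  exact ⟨ε, hε, fun x hx y hy hxy => h y (hb hy) x (hb hx) hxy⟩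

/-- A continuous lift of an analytic curve through an immersion is analytic. -/
lemma ImmersiveAt.analyticAt_lift {γ δ : ℝ → M} {t : ℝ} {τ : ℝ → ℝ}
    (hγ : ImmersiveAt E γ (τ t)) (hδ : ContMDiffAt 𝓘(ℝ, ℝ) 𝓘(ℝ, E) ω δ t)
    (hτ : ContinuousAt τ t) (h : ∀ᶠ x in 𝓝 t, γ (τ x) = δ x) : AnalyticAt ℝ τ t := by
  obtain ⟨ρ, hρ, hρt, hev⟩ := hγ.exists_local_lift hδ h.self_of_nhds
  refine hρ.congr ?_
  have h2 : Tendsto (fun x => (x, τ x)) (𝓝 t) (𝓝 (t, τ t)) :=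
    (continuousAt_id.prodMk hτ)
  filter_upwards [h, h2.eventually hev] with x hx h3
  exact (h3 hx).symm

end AnalyticCurves

/-! ### Germs of the action along the curve -/

section Germs

/-- `γ` near `s` is the translate `k • γ` near `t`, up to an analytic change of parameter `τ` with
`τ t = s`. The sign of `ε` is that of the derivative of `τ` at `t`, so that `ε = 1` means that the
orientation is preserved and `ε = -1` that it is reversed. -/
def GermLift {G M : Type*} [SMul G M] (γ : ℝ → M) (k : G) (ε t s : ℝ) : Prop :=
  ∃ τ : ℝ → ℝ, τ t = s ∧ AnalyticAt ℝ τ t ∧ 0 < ε * deriv τ t ∧ ∀ᶠ x in 𝓝 t, γ (τ x) = k • γ x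

variable {G : Type*} [Group G]
  {M : Type*} [MulAction G M] {γ : ℝ → M} {I : Set ℝ}

lemma mem_curveStabilizer {k : G} :
    k ∈ curveStabilizer G γ I ↔ ∀ t ∈ I, k • γ t = γ t := by
  simp [curveStabilizer, Subgroup.mem_iInf, MulAction.mem_stabilizer_iff]

lemma smul_eq_smul_of_mem_stabilizer {k g : G} (hkg : k⁻¹ * g ∈ curveStabilizer G γ I) {t : ℝ}
    (ht : t ∈ I) : k • γ t = g • γ t := by
  have := mem_curveStabilizer.1 hkg t ht
  rw [mul_smul, inv_smul_eq_iff] at this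
  exact this.symm

lemma curveClass_eq_iff {k l : G} :
    curveClass γ I k = curveClass γ I l ↔ k⁻¹ * l ∈ curveStabilizer G γ I :=
  QuotientGroup.eq

lemma curveClass_ne_one_iff {k : G} :
    curveClass γ I k ≠ curveClass γ I 1 ↔ k ∉ curveStabilizer G γ I := by
  rw [Ne, curveClass_eq_iff, mul_one, Subgroup.inv_mem_iff]

lemma GermLift.of_mem_stabilizer (hI : IsOpen I) {k : G} (hk : k ∈ curveStabilizer G γ I) {t : ℝ}
    (ht : t ∈ I) : GermLift γ k 1 t t := by
  refine ⟨id, rfl, analyticAt_id, by simp, ?_⟩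
  filter_upwards [hI.mem_nhds ht] with x hx using (mem_curveStabilizer.1 hk x hx).symm

lemma GermLift.comp {k l : G} {ε ε' t s r : ℝ} (h : GermLift γ k ε t s)
    (h' : GermLift γ l ε' s r) : GermLift γ (l * k) (ε' * ε) t r := by
  obtain ⟨τ, rfl, hτ, hd, he⟩ := h
  obtain ⟨σ, rfl, hσ, hd', he'⟩ := h'
  refine ⟨σ ∘ τ, rfl, hσ.comp hτ, ?_, ?_⟩
  · rw [deriv_comp t hσ.differentiableAt hτ.differentiableAt]
    nlinarith [mul_pos hd hd']
  · filter_upwards [he, hτ.continuousAt.eventually he'] with x h1 h2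
    rw [Function.comp_apply, h2, h1, mul_smul]

lemma GermLift.symm {k : G} {ε t s : ℝ} (h : GermLift γ k ε t s) : GermLift γ k⁻¹ ε s t := by
  obtain ⟨τ, rfl, hτ, hd, he⟩ := h
  have hd0 : deriv τ t ≠ 0 := by rintro h0; simp [h0] at hd
  have hs := hτ.hasStrictDerivAt
  have hl : hs.localInverse _ _ _ hd0 (τ t) = t := HasStrictFDerivAt.localInverse_apply_image ..
  refine ⟨hs.localInverse _ _ _ hd0, hl, hτ.analyticAt_localInverse hd0, ?_, ?_⟩
  · rw [(hs.to_localInverse hd0).hasDerivAt.deriv]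
    have : ε * (deriv τ t)⁻¹ = (ε * deriv τ t) * ((deriv τ t)⁻¹) ^ 2 := by field_simp
    rw [this]; positivity
  · have hc : Tendsto (hs.localInverse _ _ _ hd0) (𝓝 (τ t)) (𝓝 t) := by
      have := (hτ.analyticAt_localInverse hd0).continuousAt.tendsto
      rwa [hl] at this
    filter_upwards [hs.eventually_right_inverse hd0, hc.eventually he] with y h1 h2
    rw [eq_inv_smul_iff, ← h2, h1]

/-- A germ propagates to nearby parameters. -/
lemma GermLift.exists_eventually {k : G} {ε t s : ℝ} (h : GermLift γ k ε t s) :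
    ∃ τ : ℝ → ℝ, τ t = s ∧ AnalyticAt ℝ τ t ∧ 0 < ε * deriv τ t ∧
      ∀ᶠ x in 𝓝 t, GermLift γ k ε x (τ x) := by
  obtain ⟨τ, hs, hτ, hd, he⟩ := h
  refine ⟨τ, hs, hτ, hd, ?_⟩
  have h1 : ∀ᶠ x in 𝓝 t, 0 < ε * deriv τ x :=
    (continuousAt_const.mul hτ.deriv.continuousAt).eventually (lt_mem_nhds hd)
  filter_upwards [hτ.eventually_analyticAt, h1, he.eventually_nhds] with x hx1 hx2 hx3
  exact ⟨τ, rfl, hx1, hx2, hx3⟩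

lemma GermLift.smul_eq {k : G} {ε t s : ℝ} (h : GermLift γ k ε t s) : γ s = k • γ t := by
  obtain ⟨τ, rfl, -, -, he⟩ := h
  exact he.self_of_nhds

variable {E : Type*} [NormedAddCommGroup E] [NormedSpace ℝ E]
  [TopologicalSpace M] [ChartedSpace E M]

lemma ImmersiveAt.smul (hM : ∀ g : G, ContMDiff 𝓘(ℝ, E) 𝓘(ℝ, E) ω (fun x : M => g • x))
    {t : ℝ} (h : ImmersiveAt E γ t) (k : G) : ImmersiveAt E (fun x => k • γ x) t := by
  refine ⟨(hM k).contMDiffAt.comp t h.1, ?_⟩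
  have hd : MDifferentiableAt 𝓘(ℝ, ℝ) 𝓘(ℝ, E) γ t := h.1.mdifferentiableAt (by simp)
  have hk (g : G) : MDifferentiable 𝓘(ℝ, E) 𝓘(ℝ, E) (fun x : M => g • x) :=
    (hM g).mdifferentiable (by simp)
  have h1 := mfderiv_comp t (hk k _) hd
  have h2 := mfderiv_comp t (hk k⁻¹ _) ((hk k _).comp t hd)
  have h3 : (fun x : M => k⁻¹ • x) ∘ (fun x : M => k • x) ∘ γ = γ := by
    ext x; simp
  rw [h3] at h2
  intro x y hxy
  apply h.2
  rw [h2]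
  exact congrArg (mfderiv 𝓘(ℝ, E) 𝓘(ℝ, E) (fun x : M => k⁻¹ • x) (k • γ t)) hxy

lemma exists_nhds_isAnalyticEmbedding [FiniteDimensional ℝ E] [T2Space M]
    (hI : IsOpen I) (hγ : ∀ t ∈ I, ImmersiveAt E γ t) {t : ℝ} (ht : t ∈ I) :
    ∃ W ∈ 𝓝 t, ∀ J ⊆ W, IsOpenInterval J → IsAnalyticEmbedding E γ J := by
  obtain ⟨ε, hε, hinj⟩ := (hγ t ht).exists_injOn
  obtain ⟨η, hη, hηI⟩ := Metric.nhds_basis_closedBall.mem_iff.1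
    (inter_mem (hI.mem_nhds ht) (Ioo_mem_nhds (by linarith : t - ε < t) (by linarith : t < t + ε)))
  set K := Metric.closedBall t η
  have hc : Continuous (K.domRestrict γ) := by
    rw [← continuousOn_iff_continuous_domRestrict]
    exact fun x hx => (hγ x (hηI hx).1).continuousAt.continuousWithinAt
  have hK : CompactSpace K := isCompact_iff_compactSpace.1 (isCompact_closedBall t η)
  have hemb : IsEmbedding (K.domRestrict γ) := by
    refine (hc.isClosedEmbedding ?_).isEmbedding
    exact injOn_iff_injective.1 (hinj.mono fun x hx => (hηI hx).2)
  refine ⟨K, Metric.closedBall_mem_nhds t hη, fun J hJ hJi =>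
    ⟨J, γ, hJi, subset_rfl, fun _ _ => rfl, ⟨?_, ?_⟩, ?_⟩⟩
  · exact fun x hx => (hγ x (hηI (hJ hx)).1).1.contMDiffWithinAt
  · exact fun x hx => (hγ x (hηI (hJ hx)).1).2
  · exact hemb.comp (IsEmbedding.inclusion hJ)

/-- An element that fixes `γ` at parameters accumulating at a point of `I` fixes the curve. -/
lemma mem_curveStabilizer_of_frequently [FiniteDimensional ℝ E] [T2Space M]
    (hM : ∀ g : G, ContMDiff 𝓘(ℝ, E) 𝓘(ℝ, E) ω (fun x : M => g • x))
    (hI : IsOpenInterval I) (hγ : ∀ t ∈ I, ImmersiveAt E γ t) {k : G} {t : ℝ} (ht : t ∈ I)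
    (h : ∃ᶠ x in 𝓝[≠] t, k • γ x = γ x) : k ∈ curveStabilizer G γ I := by
  rw [mem_curveStabilizer]
  intro x hx
  exact (eventuallyEq_of_analytic_of_frequently_eq hI.1.1.isPreconnected
    (fun x hx => ((hγ x hx).smul hM k).1) (fun x hx => (hγ x hx).1) ht h x hx).eq_of_nhds

/-- In a free segment, germs at interior points come from the stabilizer only. -/
lemma IsFreeSegment.mem_stabilizer [FiniteDimensional ℝ E] [T2Space M]
    (hM : ∀ g : G, ContMDiff 𝓘(ℝ, E) 𝓘(ℝ, E) ω (fun x : M => g • x))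
    (hI : IsOpenInterval I) (hγ : ∀ t ∈ I, ImmersiveAt E γ t) {D : Set ℝ} (hD : D ⊆ I)
    (hfree : IsFreeSegment G E γ D) {k : G} {ε t s : ℝ} (ht : t ∈ interior D)
    (hs : s ∈ interior D) (h : GermLift γ k ε t s) : k ∈ curveStabilizer G γ I := by
  have key : ∀ x ∈ D, k • γ x = γ x := by
    refine hfree.2 k ?_
    -- The germ gives an overlap on a ball `J` so small that `τ` is a homeomorphism onto its image
    -- and that both curves are embeddings.
    obtain ⟨τ, rfl, hτ, hd, he⟩ := h
    have hd0 : deriv τ t ≠ 0 := by rintro h0; simp [h0] at hd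
    have hs' := hτ.hasStrictDerivAt
    set e := (hs'.hasStrictFDerivAt_equiv hd0).toOpenPartialHomeomorph τ
    have hte : t ∈ e.source := HasStrictFDerivAt.mem_toOpenPartialHomeomorph_source _
    obtain ⟨W₁, hW₁, h1⟩ := exists_nhds_isAnalyticEmbedding hI.2
      (fun x hx => (hγ x hx).smul hM k) (hD (interior_subset ht))
    obtain ⟨W₂, hW₂, h2⟩ := exists_nhds_isAnalyticEmbedding hI.2 hγ (hD (interior_subset hs))
    have hN : W₁ ∩ interior D ∩ e.source ∩ {x | γ (τ x) = k • γ x} ∩ τ ⁻¹' (W₂ ∩ interior D)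
        ∈ 𝓝 t :=
      inter_mem (inter_mem (inter_mem (inter_mem hW₁ (isOpen_interior.mem_nhds ht))
        (e.open_source.mem_nhds hte)) he)
        (hτ.continuousAt (inter_mem hW₂ (isOpen_interior.mem_nhds hs)))
    obtain ⟨η, hη, hb⟩ := Metric.mem_nhds_iff.1 hN
    set J := Metric.ball t η
    have hJo : IsOpenInterval J := by
      refine ⟨⟨?_, ?_⟩, Metric.isOpen_ball⟩
      · rw [show J = Ioo (t - η) (t + η) from Real.ball_eq_Ioo t η]; exact ordConnected_Ioo
      · rw [Metric.isOpen_ball.interior_eq]; exact ⟨t, Metric.mem_ball_self hη⟩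
    have hJe : J ⊆ e.source := fun x hx => (hb hx).1.1.2
    have hJ'open : IsOpen (τ '' J) := e.isOpen_image_of_subset_source Metric.isOpen_ball hJe
    have hJ'o : IsOpenInterval (τ '' J) := by
      refine ⟨⟨?_, ?_⟩, hJ'open⟩
      · exact (hJo.1.1.isPreconnected.image τ (e.continuousOn.mono hJe)).ordConnected
      · rw [hJ'open.interior_eq]; exact ⟨τ t, t, Metric.mem_ball_self hη, rfl⟩
    refine ⟨J, τ '' J, hJo, hJ'o, fun x hx => interior_subset (hb hx).1.1.1.2, ?_,
      h1 J (fun x hx => (hb hx).1.1.1.1) hJo, h2 _ ?_ hJ'o, ?_⟩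
    · rintro _ ⟨x, hx, rfl⟩; exact interior_subset (hb hx).2.2
    · rintro _ ⟨x, hx, rfl⟩; exact (hb hx).2.1
    · rw [image_image]
      exact image_congr fun x hx => (hb hx).1.2.symm
  refine mem_curveStabilizer_of_frequently hM hI hγ (hD (interior_subset ht)) (Eventually.frequently ?_)
  exact nhdsWithin_le_nhds (by
    filter_upwards [isOpen_interior.mem_nhds ht] with x hx using key x (interior_subset hx))

/-- A continuous lift of `k • γ` through `γ` gives germs. -/
lemma GermLift.of_continuousAt [FiniteDimensional ℝ E]
    (hM : ∀ g : G, ContMDiff 𝓘(ℝ, E) 𝓘(ℝ, E) ω (fun x : M => g • x))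
    (hγ : ∀ t ∈ I, ImmersiveAt E γ t) {k : G} {t : ℝ} {τ : ℝ → ℝ} (ht : t ∈ I) (hs : τ t ∈ I)
    (hτ : ContinuousAt τ t) (h : ∀ᶠ x in 𝓝 t, γ (τ x) = k • γ x) :
    ∃ ε, GermLift γ k ε t (τ t) := by
  have ha := (hγ _ hs).analyticAt_lift ((hγ t ht).smul hM k).1 hτ h
  have hd := ((hγ t ht).smul hM k).deriv_lift_ne_zero (hγ _ hs) ha.differentiableAt h
  exact ⟨deriv τ t, τ, rfl, ha, mul_self_pos.2 hd, h⟩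

/-- The relation given by the germs of `k` is closed: by local uniqueness, all germs of `k` close to
`(t, s)` lie on one analytic graph, which is then itself a germ by the identity theorem. -/
lemma GermLift.of_frequently [FiniteDimensional ℝ E] [T2Space M]
    (hM : ∀ g : G, ContMDiff 𝓘(ℝ, E) 𝓘(ℝ, E) ω (fun x : M => g • x))
    (hI : IsOpen I) (hγ : ∀ t ∈ I, ImmersiveAt E γ t) {k : G} {t s : ℝ} (ht : t ∈ I) (hs : s ∈ I)
    (h : ∃ᶠ p : ℝ × ℝ in 𝓝 (t, s), ∃ ε, GermLift γ k ε p.1 p.2) :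
    ∃ ε, GermLift γ k ε t s := by
  have hk := fun x hx => (hγ x hx).smul hM k
  have h0 : γ s = k • γ t := by
    have h1 : Tendsto (fun p : ℝ × ℝ => γ p.2) (𝓝 (t, s)) (𝓝 (γ s)) :=
      (hγ s hs).continuousAt.tendsto.comp continuousAt_snd
    have h2 : Tendsto (fun p : ℝ × ℝ => k • γ p.1) (𝓝 (t, s)) (𝓝 (k • γ t)) :=
      (hk t ht).continuousAt.tendsto.comp continuousAt_fst
    exact tendsto_nhds_unique_of_frequently_eq h1 h2 (h.mono fun p ⟨ε, hp⟩ => hp.smul_eq)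
  obtain ⟨ρ, hρ, hρt, hev⟩ := (hγ s hs).exists_local_lift (hk t ht).1 h0
  have hρI : ∀ᶠ x in 𝓝 t, ρ x ∈ I :=
    hρ.continuousAt.eventually (by rw [hρt]; exact hI.mem_nhds hs)
  obtain ⟨η, hη, hb⟩ := Metric.eventually_nhds_iff_ball.1
    ((hρ.eventually_analyticAt.and hρI).and (hI.mem_nhds ht))
  have hpη : ∀ᶠ p : ℝ × ℝ in 𝓝 (t, s), p.1 ∈ Metric.ball t η :=
    continuousAt_fst.eventually (Metric.ball_mem_nhds t hη)
  obtain ⟨p, ⟨ε, τ, hτp, hτ, -, he⟩, hpev, hpη⟩ :=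
    (h.and_eventually (hev.eventually_nhds.and hpη)).exists
  have hlim : Tendsto (fun x => (x, τ x)) (𝓝 p.1) (𝓝 p) := by
    have := (continuousAt_id.prodMk hτ.continuousAt : ContinuousAt (fun x => (x, τ x)) p.1)
    rw [ContinuousAt, hτp] at this
    exact this
  have hp1 : ∀ᶠ x in 𝓝 p.1, γ (ρ x) = k • γ x := by
    filter_upwards [he, hlim.eventually hpev] with x hx1 hx2
    rw [← hx2 hx1, hx1]
  have hall := eventuallyEq_of_analytic_of_frequently_eq (U := Metric.ball t η) (f := fun x => γ (ρ x))
    (g := fun x => k • γ x) (by rw [Real.ball_eq_Ioo]; exact isPreconnected_Ioo)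
    (fun x hx => (hγ _ (hb x hx).1.2).1.comp_analyticAt (hb x hx).1.1)
    (fun x hx => (hk x (hb x hx).2).1) hpη
    (Eventually.frequently (nhdsWithin_le_nhds hp1)) t (Metric.mem_ball_self hη)
  rw [← hρt]
  exact GermLift.of_continuousAt hM hγ ht (by rw [hρt]; exact hs) hρ.continuousAt hall

/-- An overlap of `k • γ` and `γ` yields germs along an interval. -/
lemma Overlap.exists_germLift [FiniteDimensional ℝ E]
    (hM : ∀ g : G, ContMDiff 𝓘(ℝ, E) 𝓘(ℝ, E) ω (fun x : M => g • x))
    (hγ : ∀ t ∈ I, ImmersiveAt E γ t) {D : Set ℝ} (hD : D ⊆ I) {k : G}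
    (h : Overlap E (fun t => k • γ t) D γ D) :
    ∃ (J : Set ℝ) (τ : ℝ → ℝ), J.Nonempty ∧ IsOpen J ∧ J ⊆ D ∧ MapsTo τ J D ∧
      InjOn τ J ∧ ∀ t ∈ J, ∃ ε, GermLift γ k ε t (τ t) := by
  obtain ⟨J, J', hJ, hJ', hJD, hJD', ⟨K, δ, hK, hJK, hδ, -, hemb⟩,
    ⟨K', δ', hK', hJK', hδ', -, hemb'⟩, himg⟩ := h
  have hex : ∀ x : ℝ, ∃ y : ℝ, x ∈ J → y ∈ J' ∧ γ y = k • γ x := by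
    intro x
    by_cases hx : x ∈ J
    · obtain ⟨y, hy, hyx⟩ := himg.subset (mem_image_of_mem (fun t => k • γ t) hx)
      exact ⟨y, fun _ => ⟨hy, hyx⟩⟩
    · exact ⟨0, fun h => absurd h hx⟩
  choose τ hτ using hex
  have hcont : ContinuousOn τ J := by
    have h1 : Continuous (fun x : J => (⟨τ x, hJK' (hτ x x.2).1⟩ : K')) := by
      rw [hemb'.isInducing.continuous_iff]
      have : (K'.domRestrict δ' ∘ fun x : J => (⟨τ x, hJK' (hτ x x.2).1⟩ : K'))
          = fun x : J => k • γ x := by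
        ext x
        simp only [Function.comp_apply, domRestrict_apply]
        rw [hδ' (hτ x x.2).1, (hτ x x.2).2]
      rw [this]
      have h2 := fun x : J => ((hγ x (hD (hJD x.2))).smul hM k).continuousAt
      exact continuous_iff_continuousAt.2 fun x => (h2 x).comp continuousAt_subtype_val
    rw [continuousOn_iff_continuous_domRestrict]
    exact continuous_subtype_val.comp h1
  refine ⟨J, τ, ?_, hJ.2, hJD, fun x hx => hJD' (hτ x hx).1, ?_, ?_⟩
  · have := hJ.1.2; rwa [hJ.2.interior_eq] at this
  · intro x hx y hy hxy
    have h1 : δ x = δ y := by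
      rw [hδ hx, hδ hy]
      simp only
      rw [← (hτ x hx).2, ← (hτ y hy).2, hxy]
    have := hemb.injective (a₁ := ⟨x, hJK hx⟩) (a₂ := ⟨y, hJK hy⟩) h1
    exact congrArg Subtype.val this
  · intro x hx
    refine GermLift.of_continuousAt hM hγ (hD (hJD hx)) (hD (hJD' (hτ x hx).1))
      (hcont.continuousAt (hJ.2.mem_nhds hx)) ?_
    filter_upwards [hJ.2.mem_nhds hx] with y hy using (hτ y hy).2

end Germs

/-! ### Orientation of reparametrizations -/

section Reparametrizations

/-- If the derivative of `τ` at `t` has the sign of `ε`, then so has the slope of `τ` near `t`. -/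
lemma eventually_slope_pos {τ : ℝ → ℝ} {ε t : ℝ} (hτ : DifferentiableAt ℝ τ t)
    (hd : 0 < ε * deriv τ t) : ∀ᶠ x in 𝓝[≠] t, 0 < ε * (τ x - τ t) * (x - t) := by
  have h1 := (hasDerivAt_iff_tendsto_slope.1 hτ.hasDerivAt).const_mul ε
  filter_upwards [h1.eventually (lt_mem_nhds hd), self_mem_nhdsWithin] with x hx hne
  have hne' : x - t ≠ 0 := sub_ne_zero.2 hne
  have : ε * (τ x - τ t) * (x - t) = (ε * slope τ t x) * (x - t) ^ 2 := by
    rw [slope_def_field]; field_simp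
  rw [this]
  positivity

/-- `δ` on `[α, β]` corresponds to `γ` on `P` by the change of parameter `τ : D → P`, where `D` is
all of `[α, β]` or a half-open initial or final piece of it, and `τ` is analytic on the open
interval `U ⊇ D`. The orientation is preserved for `ε = 1`, and reversed for `ε = -1`. Unlike in
`RelAt`, the monotonicity of `τ` is part of the data. -/
structure ReparamOn {M : Type*} (δ : ℝ → M) (α β : ℝ) (γ : ℝ → M) (P : Set ℝ) (ε : ℝ)
    (D U : Set ℝ) (τ : ℝ → ℝ) : Prop where
  shape : D = Icc α β ∨ (∃ j, α < j ∧ j ≤ β ∧ D = Ico α j) ∨ (∃ j, α ≤ j ∧ j < β ∧ D = Ioc j β)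
  isOpenInterval : IsOpenInterval U
  subset : D ⊆ U
  analytic : AnalyticOnNhd ℝ τ U
  image : τ '' D = P
  eq : ∀ x ∈ D, δ x = γ (τ x)
  deriv_pos : ∀ x ∈ U, 0 < ε * deriv τ x
  mono : StrictMonoOn (fun x => ε * τ x) U
  exists_inv : ∃ σ : ℝ → ℝ, ContinuousOn σ P ∧ ∀ x ∈ D, σ (τ x) = x

variable {M : Type*} {δ γ : ℝ → M} {α β ε : ℝ} {P D U : Set ℝ} {τ : ℝ → ℝ}

lemma RelAt.exists_reparam {t t' : ℝ} (h : RelAt δ D t γ P t')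
    (hs : D = Icc α β ∨ (∃ j, α < j ∧ j ≤ β ∧ D = Ico α j) ∨ (∃ j, α ≤ j ∧ j < β ∧ D = Ioc j β)) :
    ∃ U τ, τ t = t' ∧ (ReparamOn δ α β γ P 1 D U τ ∨ ReparamOn δ α β γ P (-1) D U τ) := by
  obtain ⟨ht, ht', ρ, ⟨himg, U, V, τ, σ, hU, hV, hDU, heq, hτ, hσ, hinv, hτa, hσa⟩, hρ, hγ⟩ := h
  have hne : ∀ x ∈ U, deriv τ x ≠ 0 := by
    intro x hx h0
    have h1 : HasDerivAt (σ ∘ τ) (deriv σ (τ x) * deriv τ x) x :=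
      (hσa _ (hτ hx)).differentiableAt.hasDerivAt.comp x (hτa x hx).differentiableAt.hasDerivAt
    have h2 : HasDerivAt (σ ∘ τ) 1 x := by
      refine (hasDerivAt_id x).congr_of_eventuallyEq ?_
      filter_upwards [hU.2.mem_nhds hx] with y hy using hinv.1 hy
    have h3 := h1.unique h2
    rw [h0, mul_zero] at h3
    exact zero_ne_one h3
  have hconv : Convex ℝ U := hU.1.1.convex
  have hcont : ContinuousOn τ U := hτa.continuousOn
  refine ⟨U, τ, (heq ht).trans hρ, ?_⟩
  have himg' : τ '' D = P := by rw [← himg]; exact image_congr heq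
  have hγ' : ∀ x ∈ D, δ x = γ (τ x) := fun x hx => by rw [heq hx, hγ x hx]
  have hσ' : ContinuousOn σ P ∧ ∀ x ∈ D, σ (τ x) = x := by
    refine ⟨hσa.continuousOn.mono ?_, fun x hx => hinv.1 (hDU hx)⟩
    rw [← himg']
    exact image_subset_iff.2 fun x hx => hτ (hDU hx)
  rcases hasDerivWithinAt_forall_lt_or_forall_gt_of_forall_ne (m := 0) hconv
    (fun x hx => (hτa x hx).differentiableAt.hasDerivAt.hasDerivWithinAt) hne with hneg | hpos
  · right
    refine ⟨hs, hU, hDU, hτa, himg', hγ', fun x hx => by linarith [hneg x hx], ?_, σ, hσ'⟩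
    have := strictAntiOn_of_deriv_neg hconv hcont fun x hx => hneg x (interior_subset hx)
    intro x hx y hy hxy
    have := this hx hy hxy
    simp only; linarith
  · left
    refine ⟨hs, hU, hDU, hτa, himg', hγ', fun x hx => by linarith [hpos x hx], ?_, σ, hσ'⟩
    have := strictMonoOn_of_deriv_pos hconv hcont fun x hx => hpos x (interior_subset hx)
    intro x hx y hy hxy
    have := this hx hy hxy
    simp only; linarith

lemma PosRel.exists_reparam (hαβ : α < β) (h : PosRel δ α β γ P) :
    ∃ D U τ, ReparamOn δ α β γ P 1 D U τ := by
  rcases h with ⟨a', ha', h⟩ | ⟨a', ha', j, hj, hj', h⟩ | ⟨b', hb', j, hj, hj', h⟩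
  · obtain ⟨U, τ, hτ, hr | hr⟩ := h.exists_reparam (α := α) (β := β) (Or.inl rfl)
    · exact ⟨_, U, τ, hr⟩
    · have h1 := hr.mono (hr.subset (left_mem_Icc.2 hαβ.le)) (hr.subset (right_mem_Icc.2 hαβ.le)) hαβ
      have h2 := ha'.2 (hr.image ▸ mem_image_of_mem τ (right_mem_Icc.2 hαβ.le))
      simp only at h1
      linarith
  · obtain ⟨U, τ, hτ, hr | hr⟩ :=
      h.exists_reparam (α := α) (β := β) (Or.inr (Or.inl ⟨j, hj, hj', rfl⟩))
    · exact ⟨_, U, τ, hr⟩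
    · have hm : (α + j) / 2 ∈ Ico α j := ⟨by linarith, by linarith⟩
      have h1 := hr.mono (hr.subset (left_mem_Ico.2 hj)) (hr.subset hm)
        (by linarith : α < (α + j) / 2)
      have h2 := ha'.2 (hr.image ▸ mem_image_of_mem τ hm)
      simp only at h1
      linarith
  · obtain ⟨U, τ, hτ, hr | hr⟩ :=
      h.exists_reparam (α := α) (β := β) (Or.inr (Or.inr ⟨j, hj, hj', rfl⟩))
    · exact ⟨_, U, τ, hr⟩
    · have hm : (j + β) / 2 ∈ Ioc j β := ⟨by linarith, by linarith⟩
      have h1 := hr.mono (hr.subset hm) (hr.subset (right_mem_Ioc.2 hj'))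
        (by linarith : (j + β) / 2 < β)
      have h2 := hb'.2 (hr.image ▸ mem_image_of_mem τ hm)
      simp only at h1
      linarith

lemma NegRel.exists_reparam (hαβ : α < β) (h : NegRel δ α β γ P) :
    ∃ D U τ, ReparamOn δ α β γ P (-1) D U τ := by
  rcases h with ⟨a', ha', h⟩ | ⟨a', ha', j, hj, hj', h⟩ | ⟨b', hb', j, hj, hj', h⟩
  · obtain ⟨U, τ, hτ, hr | hr⟩ := h.exists_reparam (α := α) (β := β) (Or.inl rfl)
    · have h1 := hr.mono (hr.subset (left_mem_Icc.2 hαβ.le)) (hr.subset (right_mem_Icc.2 hαβ.le)) hαβ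
      have h2 := ha'.2 (hr.image ▸ mem_image_of_mem τ (right_mem_Icc.2 hαβ.le))
      simp only at h1
      linarith
    · exact ⟨_, U, τ, hr⟩
  · obtain ⟨U, τ, hτ, hr | hr⟩ :=
      h.exists_reparam (α := α) (β := β) (Or.inr (Or.inr ⟨j, hj, hj', rfl⟩))
    · have hm : (j + β) / 2 ∈ Ioc j β := ⟨by linarith, by linarith⟩
      have h1 := hr.mono (hr.subset hm) (hr.subset (right_mem_Ioc.2 hj'))
        (by linarith : (j + β) / 2 < β)
      have h2 := ha'.2 (hr.image ▸ mem_image_of_mem τ hm)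
      simp only at h1
      linarith
    · exact ⟨_, U, τ, hr⟩
  · obtain ⟨U, τ, hτ, hr | hr⟩ :=
      h.exists_reparam (α := α) (β := β) (Or.inr (Or.inl ⟨j, hj, hj', rfl⟩))
    · have hm : (α + j) / 2 ∈ Ico α j := ⟨by linarith, by linarith⟩
      have h1 := hr.mono (hr.subset (left_mem_Ico.2 hj)) (hr.subset hm)
        (by linarith : α < (α + j) / 2)
      have h2 := hb'.2 (hr.image ▸ mem_image_of_mem τ hm)
      simp only at h1
      linarith
    · exact ⟨_, U, τ, hr⟩

lemma RelAt.congr {δ' : ℝ → M} {t t' : ℝ} (h : RelAt δ D t γ P t') (hD : ∀ x ∈ D, δ' x = δ x) :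
    RelAt δ' D t γ P t' := by
  obtain ⟨h1, h2, ρ, h3, h4, h5⟩ := h
  exact ⟨h1, h2, ρ, h3, h4, fun s hs => (hD s hs).trans (h5 s hs)⟩

lemma PosRel.congr {δ' : ℝ → M} (h : PosRel δ α β γ P) (hD : ∀ x ∈ Icc α β, δ' x = δ x) :
    PosRel δ' α β γ P := by
  rcases h with ⟨a', ha', h⟩ | ⟨a', ha', j, hj, hj', h⟩ | ⟨b', hb', j, hj, hj', h⟩
  · exact Or.inl ⟨a', ha', h.congr hD⟩
  · exact Or.inr (Or.inl ⟨a', ha', j, hj, hj', h.congr fun x hx => hD x ⟨hx.1, hx.2.le.trans hj'⟩⟩)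
  · exact Or.inr (Or.inr ⟨b', hb', j, hj, hj', h.congr fun x hx => hD x ⟨hj.trans hx.1.le, hx.2⟩⟩)

namespace ReparamOn

lemma subset_Icc (h : ReparamOn δ α β γ P ε D U τ) : D ⊆ Icc α β := by
  rcases h.shape with rfl | ⟨j, h1, h2, rfl⟩ | ⟨j, h1, h2, rfl⟩
  · exact subset_rfl
  · exact fun x hx => ⟨hx.1, hx.2.le.trans h2⟩
  · exact fun x hx => ⟨h1.trans hx.1.le, hx.2⟩

lemma eq_left_of_isLeast (h : ReparamOn δ α β γ P ε D U τ) {d : ℝ} (hd : IsLeast D d) : d = α := by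
  rcases h.shape with rfl | ⟨j, h1, h2, rfl⟩ | ⟨j, h1, h2, rfl⟩
  · exact le_antisymm (hd.2 (left_mem_Icc.2 (hd.1.1.trans hd.1.2))) hd.1.1
  · exact le_antisymm (hd.2 (left_mem_Ico.2 h1)) hd.1.1
  · have h3 := hd.1.1
    have h4 := hd.1.2
    have := hd.2 (⟨by linarith, by linarith⟩ : (j + d) / 2 ∈ Ioc j β)
    linarith

lemma eq_right_of_isGreatest (h : ReparamOn δ α β γ P ε D U τ) {d : ℝ} (hd : IsGreatest D d) :
    d = β := by
  rcases h.shape with rfl | ⟨j, h1, h2, rfl⟩ | ⟨j, h1, h2, rfl⟩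
  · exact le_antisymm hd.1.2 (hd.2 (right_mem_Icc.2 (hd.1.1.trans hd.1.2)))
  · have h3 := hd.1.1
    have h4 := hd.1.2
    have := hd.2 (⟨by linarith, by linarith⟩ : (d + j) / 2 ∈ Ico α j)
    linarith
  · exact le_antisymm hd.1.2 (hd.2 (right_mem_Ioc.2 h2))

lemma le_iff (h : ReparamOn δ α β γ P ε D U τ) {x y : ℝ} (hx : x ∈ D) (hy : y ∈ D) :
    ε * τ x ≤ ε * τ y ↔ x ≤ y :=
  h.mono.le_iff_le (h.subset hx) (h.subset hy)

lemma left_of_isLeast (h : ReparamOn δ α β γ P 1 D U τ) {c : ℝ} (hc : IsLeast P c) :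
    α ∈ D ∧ τ α = c := by
  have h1 := hc.1
  rw [← h.image] at h1
  obtain ⟨d, hd, rfl⟩ := h1
  have : IsLeast D d := ⟨hd, fun x hx => by
    rw [← h.le_iff hd hx]
    linarith [hc.2 (h.image ▸ mem_image_of_mem τ hx)]⟩
  have := h.eq_left_of_isLeast this
  subst this
  exact ⟨hd, rfl⟩

lemma right_of_isGreatest (h : ReparamOn δ α β γ P 1 D U τ) {c : ℝ} (hc : IsGreatest P c) :
    β ∈ D ∧ τ β = c := by
  have h1 := hc.1
  rw [← h.image] at h1
  obtain ⟨d, hd, rfl⟩ := h1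
  have : IsGreatest D d := ⟨hd, fun x hx => by
    rw [← h.le_iff hx hd]
    linarith [hc.2 (h.image ▸ mem_image_of_mem τ hx)]⟩
  have := h.eq_right_of_isGreatest this
  subst this
  exact ⟨hd, rfl⟩

lemma right_of_isLeast (h : ReparamOn δ α β γ P (-1) D U τ) {c : ℝ} (hc : IsLeast P c) :
    β ∈ D ∧ τ β = c := by
  have h1 := hc.1
  rw [← h.image] at h1
  obtain ⟨d, hd, rfl⟩ := h1
  have : IsGreatest D d := ⟨hd, fun x hx => by
    rw [← h.le_iff hx hd]
    linarith [hc.2 (h.image ▸ mem_image_of_mem τ hx)]⟩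
  have := h.eq_right_of_isGreatest this
  subst this
  exact ⟨hd, rfl⟩

lemma left_of_isGreatest (h : ReparamOn δ α β γ P (-1) D U τ) {c : ℝ} (hc : IsGreatest P c) :
    α ∈ D ∧ τ α = c := by
  have h1 := hc.1
  rw [← h.image] at h1
  obtain ⟨d, hd, rfl⟩ := h1
  have : IsLeast D d := ⟨hd, fun x hx => by
    rw [← h.le_iff hd hx]
    linarith [hc.2 (h.image ▸ mem_image_of_mem τ hx)]⟩
  have := h.eq_left_of_isLeast this
  subst this
  exact ⟨hd, rfl⟩

lemma accPt (h : ReparamOn δ α β γ P ε D U τ) (hαβ : α < β) {t : ℝ} (ht : t ∈ D) :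
    ∃ᶠ x in 𝓝[≠] t, x ∈ D := by
  rw [← accPt_iff_frequently_nhdsNE]
  rcases h.shape with rfl | ⟨j, h1, h2, rfl⟩ | ⟨j, h1, h2, rfl⟩
  · refine isPreconnected_Icc.preperfect_of_nontrivial ?_ t ht
    exact (Icc_infinite hαβ).nontrivial
  · refine isPreconnected_Ico.preperfect_of_nontrivial ?_ t ht
    exact (Ioo_infinite h1).nontrivial.mono Ioo_subset_Ico_self
  · refine isPreconnected_Ioc.preperfect_of_nontrivial ?_ t ht
    exact (Ioo_infinite h2).nontrivial.mono Ioo_subset_Ioc_self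

/-- A change of parameter on a piece gives germs at all of its points, the end points included. -/
lemma germLift {G : Type*} [Group G] {M : Type*} [MulAction G M] {γ : ℝ → M} {I : Set ℝ}
    {E : Type*} [NormedAddCommGroup E] [NormedSpace ℝ E]
    [TopologicalSpace M] [ChartedSpace E M] [FiniteDimensional ℝ E] [T2Space M]
    (hM : ∀ g : G, ContMDiff 𝓘(ℝ, E) 𝓘(ℝ, E) ω (fun x : M => g • x))
    (hγ : ∀ t ∈ I, ImmersiveAt E γ t) {k : G}
    (h : ReparamOn (fun t => k • γ t) α β γ P ε D U τ)
    (hαβ : α < β) (hA : Icc α β ⊆ I) (hP : P ⊆ I) {t : ℝ} (ht : t ∈ D) :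
    GermLift γ k ε t (τ t) := by
  refine ⟨τ, rfl, h.analytic t (h.subset ht), h.deriv_pos t (h.subset ht), ?_⟩
  have hτ : τ t ∈ I := hP (h.image ▸ mem_image_of_mem τ ht)
  refine ContMDiffAt.eventuallyEq_of_frequently_eq (E := E)
    ((hγ _ hτ).1.comp_analyticAt (h.analytic t (h.subset ht)))
    ((hγ t (hA (h.subset_Icc ht))).smul hM k).1 ?_
  exact (h.accPt hαβ ht).mono fun x hx => (h.eq x hx).symm

end ReparamOn

end Reparametrizations

/-! ### Shifts of a free interval, and the pieces of a decomposition -/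

section Shift

variable {G : Type*} [Group G]
  {E : Type*} [NormedAddCommGroup E] [NormedSpace ℝ E]
  {M : Type*} [TopologicalSpace M] [ChartedSpace E M] [MulAction G M]

variable (E) in
/-- `h` carries the free interval `[α, β]` to an interval that continues `γ` beyond `β`, with `α`
going to `β` and the orientation preserved, and `h` does not fix `γ`. The ambient assumptions on
the action and on the curve are included. -/
structure IsShift (γ : ℝ → M) (I : Set ℝ) (α β : ℝ) (h : G) : Prop where
  contMDiff_smul : ∀ g : G, ContMDiff 𝓘(ℝ, E) 𝓘(ℝ, E) ω (fun x : M => g • x)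
  isOpenInterval : IsOpenInterval I
  immersiveAt : ∀ t ∈ I, ImmersiveAt E γ t
  lt : α < β
  subset : Icc α β ⊆ I
  free : IsFreeSegment G E γ (Icc α β)
  germ : GermLift γ h 1 α β
  not_mem : h ∉ curveStabilizer G γ I

variable {γ : ℝ → M} {I : Set ℝ} {α β : ℝ} {h : G}

namespace IsShift

lemma left_mem (H : IsShift E γ I α β h) : α ∈ I := H.subset (left_mem_Icc.2 H.lt.le)

lemma right_mem (H : IsShift E γ I α β h) : β ∈ I := H.subset (right_mem_Icc.2 H.lt.le)

variable [FiniteDimensional ℝ E] [T2Space M]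

lemma mem_stabilizer (H : IsShift E γ I α β h) {k : G} {ε t s : ℝ} (ht : t ∈ Ioo α β)
    (hs : s ∈ Ioo α β) (hk : GermLift γ k ε t s) : k ∈ curveStabilizer G γ I :=
  H.free.mem_stabilizer H.contMDiff_smul H.isOpenInterval H.immersiveAt H.subset
    (by rwa [interior_Icc]) (by rwa [interior_Icc]) hk

/-- In a compact interval that admits a shift the curve does not overlap itself. Otherwise, take
the non-trivial pair `(t, s)`, `t < s`, with `t` as large as possible; moving on past `t`, the
second point has to leave `[α, β]` through `β`, and the shift carries it back to `[α, β]`, so that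
freeness forces the shift to fix `γ`. -/
lemma eq_of_germLift_one_of_le (H : IsShift E γ I α β h) {ε t s : ℝ} (ht : t ∈ Icc α β)
    (hs : s ∈ Icc α β) (hts : t ≤ s) (hg : GermLift γ (1 : G) ε t s) : t = s := by
  by_contra hne
  set K : Set (ℝ × ℝ) := {p | t ≤ p.1 ∧ p.1 ≤ p.2 ∧ p.2 ≤ β ∧ p.1 ≠ p.2 ∧
    ∃ ε, GermLift γ (1 : G) ε p.1 p.2} with hKdef
  have hKne : K.Nonempty := ⟨(t, s), le_rfl, hts, hs.2, hne, ε, hg⟩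
  have hKsub : K ⊆ Icc t β ×ˢ Icc t β := fun p hp =>
    ⟨⟨hp.1, hp.2.1.trans hp.2.2.1⟩, ⟨hp.1.trans hp.2.1, hp.2.2.1⟩⟩
  have hKcl : IsClosed K := by
    refine isClosed_of_closure_subset fun p hp => ?_
    have hp' := mem_closure_iff_frequently.1 hp
    have c1 : t ≤ p.1 := (isClosed_le continuous_const continuous_fst).closure_subset_iff.2
      (fun q hq => hq.1 : K ⊆ {q | t ≤ q.1}) hp
    have c2 : p.1 ≤ p.2 := (isClosed_le continuous_fst continuous_snd).closure_subset_iff.2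
      (fun q hq => hq.2.1 : K ⊆ {q | q.1 ≤ q.2}) hp
    have c3 : p.2 ≤ β := (isClosed_le continuous_snd continuous_const).closure_subset_iff.2
      (fun q hq => hq.2.2.1 : K ⊆ {q | q.2 ≤ β}) hp
    have m1 : p.1 ∈ I := H.subset ⟨ht.1.trans c1, c2.trans c3⟩
    have m2 : p.2 ∈ I := H.subset ⟨ht.1.trans (c1.trans c2), c3⟩
    refine ⟨c1, c2, c3, fun heq => ?_, ?_⟩
    · -- The diagonal is isolated because `γ` is locally injective.
      have hev := (H.immersiveAt _ m1).eventually_injective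
      rw [show ((p.1, p.1) : ℝ × ℝ) = p from Prod.ext rfl heq] at hev
      obtain ⟨q, hq, hq'⟩ := (hp'.and_eventually hev).exists
      obtain ⟨ε, hε⟩ := hq.2.2.2.2
      exact hq.2.2.2.1 (hq' (by simpa using hε.smul_eq)).symm
    · exact GermLift.of_frequently H.contMDiff_smul H.isOpenInterval.2 H.immersiveAt m1 m2
        (hp'.mono fun q hq => hq.2.2.2.2)
  obtain ⟨p, hp, hmax⟩ := ((isCompact_Icc.prod isCompact_Icc).of_isClosed_subset hKcl
    hKsub).exists_isMaxOn hKne continuous_fst.continuousOn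
  obtain ⟨h1, h2, h3, h4, ε', h5⟩ := hp
  have h2' : p.1 < p.2 := lt_of_le_of_ne h2 h4
  obtain ⟨τ, hτp, hτ, -, hev⟩ := h5.exists_eventually
  have hlt : ∀ᶠ x in 𝓝 p.1, x < τ x :=
    continuousAt_id.eventually_lt hτ.continuousAt (by simpa [hτp] using h2')
  have hnot : ∀ᶠ x in 𝓝[>] p.1, ¬ τ x ≤ β := by
    filter_upwards [nhdsWithin_le_nhds hlt, nhdsWithin_le_nhds hev, self_mem_nhdsWithin]
      with x hx1 hx2 hx3 hx4
    have : ((x, τ x) : ℝ × ℝ) ∈ K := ⟨h1.trans (le_of_lt hx3), hx1.le, hx4, hx1.ne, ε', hx2⟩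
    exact not_le.2 hx3 (isMaxOn_iff.1 hmax _ this)
  rcases h3.lt_or_eq with h3 | h3
  · have : ∀ᶠ x in 𝓝 p.1, τ x < β :=
      hτ.continuousAt.eventually_lt continuousAt_const (by rwa [hτp])
    obtain ⟨x, hx1, hx2⟩ := (hnot.and (nhdsWithin_le_nhds this)).exists
    exact hx1 hx2.le
  · obtain ⟨σ, hσβ, hσ, hσd, hσev⟩ := H.germ.symm.exists_eventually
    have hslope := eventually_nhdsWithin_iff.1 (eventually_slope_pos hσ.differentiableAt hσd)
    have hσlt : ∀ᶠ y in 𝓝 β, σ y < β :=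
      hσ.continuousAt.eventually_lt continuousAt_const (by rw [hσβ]; exact H.lt)
    have hτ' : Tendsto τ (𝓝 p.1) (𝓝 β) := by
      have := hτ.continuousAt.tendsto; rwa [hτp, h3] at this
    have hxβ : ∀ᶠ x in 𝓝 p.1, x < β := Iio_mem_nhds (h3 ▸ h2')
    have hall := ((hτ'.eventually (hslope.and (hσlt.and hσev))).and (hev.and hxβ)).filter_mono
      (nhdsWithin_le_nhds (s := Ioi p.1))
    obtain ⟨x, ⟨hx1, ⟨hx2, hx3, hx4⟩, hx5, hx6⟩, hx7⟩ :=
      ((hnot.and hall).and self_mem_nhdsWithin).exists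
    have hx7' : p.1 < x := hx7
    have hβ : β < τ x := not_le.1 hx1
    have hασ : α < σ (τ x) := by
      have := hx2 hβ.ne'
      rw [hσβ, one_mul] at this
      have := (pos_iff_pos_of_mul_pos this).2 (sub_pos.2 hβ)
      linarith
    have hmem := H.mem_stabilizer (⟨by linarith [ht.1], hx6⟩ : x ∈ Ioo α β)
      (⟨hασ, hx3⟩ : σ (τ x) ∈ Ioo α β) (hx5.comp hx4)
    rw [mul_one] at hmem
    exact H.not_mem ((Subgroup.inv_mem_iff _).1 hmem)

lemma eq_of_germLift (H : IsShift E γ I α β h) {k : G} (hk : k ∈ curveStabilizer G γ I)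
    {ε t s : ℝ} (ht : t ∈ Icc α β) (hs : s ∈ Icc α β) (hg : GermLift γ k ε t s) : t = s := by
  have h1 := hg.comp (GermLift.of_mem_stabilizer H.isOpenInterval.2 (inv_mem hk) (H.subset hs))
  rw [inv_mul_cancel] at h1
  rcases le_total t s with hts | hts
  · exact H.eq_of_germLift_one_of_le ht hs hts h1
  · have h2 := h1.symm
    rw [inv_one] at h2
    exact (H.eq_of_germLift_one_of_le hs ht hts h2).symm

lemma mem_stabilizer_left (H : IsShift E γ I α β h) {k : G} (hk : GermLift γ k 1 α α) :
    k ∈ curveStabilizer G γ I := by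
  obtain ⟨τ, hτp, hτ, hd, hev⟩ := hk.exists_eventually
  have hslope := eventually_nhdsWithin_iff.1 (eventually_slope_pos hτ.differentiableAt hd)
  have hlt : ∀ᶠ x in 𝓝 α, τ x < β :=
    hτ.continuousAt.eventually_lt continuousAt_const (by rw [hτp]; exact H.lt)
  obtain ⟨x, ⟨⟨h1, h2⟩, h3⟩, h4⟩ := ((((hev.and hslope).and hlt).filter_mono
    (nhdsWithin_le_nhds (s := Ioi α))).and
    (Ioo_mem_nhdsGT H.lt)).exists
  have h5 := h2 h4.1.ne'
  rw [hτp, one_mul] at h5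
  have := (pos_iff_pos_of_mul_pos h5).2 (sub_pos.2 h4.1)
  exact H.mem_stabilizer h4 ⟨by linarith, h3⟩ h1

lemma mem_stabilizer_right (H : IsShift E γ I α β h) {k : G} (hk : GermLift γ k 1 β β) :
    k ∈ curveStabilizer G γ I := by
  obtain ⟨τ, hτp, hτ, hd, hev⟩ := hk.exists_eventually
  have hslope := eventually_nhdsWithin_iff.1 (eventually_slope_pos hτ.differentiableAt hd)
  have hlt : ∀ᶠ x in 𝓝 β, α < τ x :=
    continuousAt_const.eventually_lt hτ.continuousAt (by rw [hτp]; exact H.lt)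
  obtain ⟨x, ⟨⟨h1, h2⟩, h3⟩, h4⟩ := ((((hev.and hslope).and hlt).filter_mono
    (nhdsWithin_le_nhds (s := Iio β))).and
    (Ioo_mem_nhdsLT H.lt)).exists
  have h5 := h2 h4.2.ne
  rw [hτp, one_mul] at h5
  have := (neg_iff_neg_of_mul_pos h5).2 (sub_neg.2 h4.2)
  exact H.mem_stabilizer h4 ⟨h3, by linarith⟩ h1

/-- No element turns the curve around at `β`, that is, carries its germ at `α` to its reversed germ
at `β`: it would fix `γ` by freeness, and `γ` would overlap itself in `[α, β]`. -/
lemma not_germLift_neg (H : IsShift E γ I α β h) {k : G} : ¬ GermLift γ k (-1) α β := by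
  intro hk
  have hk' := hk
  obtain ⟨τ, hτp, hτ, hd, hev⟩ := hk.exists_eventually
  have hslope := eventually_nhdsWithin_iff.1 (eventually_slope_pos hτ.differentiableAt hd)
  have hlt : ∀ᶠ x in 𝓝 α, α < τ x :=
    continuousAt_const.eventually_lt hτ.continuousAt (by rw [hτp]; exact H.lt)
  obtain ⟨x, ⟨⟨h1, h2⟩, h3⟩, h4⟩ := ((((hev.and hslope).and hlt).filter_mono
    (nhdsWithin_le_nhds (s := Ioi α))).and
    (Ioo_mem_nhdsGT H.lt)).exists
  have h5 := h2 h4.1.ne'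
  rw [hτp] at h5
  have := (pos_iff_pos_of_mul_pos h5).2 (sub_pos.2 h4.1)
  have hmem := H.mem_stabilizer h4 ⟨h3, by linarith⟩ h1
  exact H.lt.ne (H.eq_of_germLift hmem (left_mem_Icc.2 H.lt.le) (right_mem_Icc.2 H.lt.le) hk')

/-- An element that carries a piece of the curve to the curve conjugates the stabilizer of the curve
into itself. -/
lemma conj_mem (H : IsShift E γ I α β h) {k l : G} {ε t s : ℝ} (ht : t ∈ I) (hs : s ∈ I)
    (hk : GermLift γ k ε t s) (hl : l ∈ curveStabilizer G γ I) :
    k⁻¹ * l * k ∈ curveStabilizer G γ I := by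
  obtain ⟨τ, rfl, hτ, -, he⟩ := hk
  refine mem_curveStabilizer_of_frequently H.contMDiff_smul H.isOpenInterval H.immersiveAt ht
    (Eventually.frequently (nhdsWithin_le_nhds ?_))
  filter_upwards [he, hτ.continuousAt (H.isOpenInterval.2.mem_nhds hs)] with x h1 h2
  rw [mul_smul, mul_smul, ← h1, mem_curveStabilizer.1 hl _ h2, h1, inv_smul_smul]

lemma mem_normalizer (H : IsShift E γ I α β h) :
    h ∈ Subgroup.normalizer (curveStabilizer G γ I : Set G) := by
  rw [Subgroup.mem_normalizer_iff]
  intro l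
  constructor
  · intro hl
    simpa using H.conj_mem H.right_mem H.left_mem H.germ.symm hl
  · intro hl
    have := H.conj_mem H.left_mem H.right_mem H.germ hl
    rwa [show h⁻¹ * (h * l * h⁻¹) * h = l by group] at this

/-- A piece to the right of a point `c` at which `k • γ|_[α, β]` continues `γ` corresponds to
`[α, β]` by `k` only, with the orientation preserved. -/
lemma posRel_of_isLeast (H : IsShift E γ I α β h) {k g : G} {c : ℝ} {P : Set ℝ}
    (hk : GermLift γ k 1 α c) (hP : P ⊆ I) (hc : IsLeast P c)
    (hg : CurveRel (fun t => g • γ t) α β γ P) :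
    k⁻¹ * g ∈ curveStabilizer G γ I ∧ PosRel (fun t => k • γ t) α β γ P := by
  rcases hg with hg | hg
  · obtain ⟨D, U, τ, hr⟩ := hg.exists_reparam H.lt
    obtain ⟨hα, hτ⟩ := hr.left_of_isLeast hc
    have h1 := hr.germLift H.contMDiff_smul H.immersiveAt H.lt H.subset hP hα
    rw [hτ] at h1
    have h2 := H.mem_stabilizer_left (by simpa using h1.comp hk.symm)
    exact ⟨h2, hg.congr fun x hx => smul_eq_smul_of_mem_stabilizer h2 (H.subset hx)⟩
  · obtain ⟨D, U, τ, hr⟩ := hg.exists_reparam H.lt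
    obtain ⟨hβ, hτ⟩ := hr.right_of_isLeast hc
    have h1 := hr.germLift H.contMDiff_smul H.immersiveAt H.lt H.subset hP hβ
    rw [hτ] at h1
    exact absurd (by simpa using hk.comp h1.symm) (H.not_germLift_neg (k := g⁻¹ * k))

lemma posRel_of_isGreatest (H : IsShift E γ I α β h) {k g : G} {c : ℝ} {P : Set ℝ}
    (hk : GermLift γ k 1 β c) (hP : P ⊆ I) (hc : IsGreatest P c)
    (hg : CurveRel (fun t => g • γ t) α β γ P) :
    k⁻¹ * g ∈ curveStabilizer G γ I ∧ PosRel (fun t => k • γ t) α β γ P := by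
  rcases hg with hg | hg
  · obtain ⟨D, U, τ, hr⟩ := hg.exists_reparam H.lt
    obtain ⟨hβ, hτ⟩ := hr.right_of_isGreatest hc
    have h1 := hr.germLift H.contMDiff_smul H.immersiveAt H.lt H.subset hP hβ
    rw [hτ] at h1
    have h2 := H.mem_stabilizer_right (by simpa using h1.comp hk.symm)
    exact ⟨h2, hg.congr fun x hx => smul_eq_smul_of_mem_stabilizer h2 (H.subset hx)⟩
  · obtain ⟨D, U, τ, hr⟩ := hg.exists_reparam H.lt
    obtain ⟨hα, hτ⟩ := hr.left_of_isGreatest hc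
    have h1 := hr.germLift H.contMDiff_smul H.immersiveAt H.lt H.subset hP hα
    rw [hτ] at h1
    exact absurd (by simpa using h1.comp hk.symm) (H.not_germLift_neg (k := k⁻¹ * g))

end IsShift

end Shift

namespace IntervalDecomp

variable {I : Set ℝ} (d : IntervalDecomp I)

/-- The points of a decomposition, numbered without a gap: `knot n` is the left end point of the
piece `n`, for `lo < n ≤ hi`. -/
def knot (n : ℤ) : ℝ := if 1 ≤ n then d.a n else d.a (n - 1)

lemma lo_lt_iff {n : ℤ} : d.lo < (n : WithBot ℤ) ↔ d.lo ≤ ((n - 1 : ℤ) : WithBot ℤ) := by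
  cases d.lo with
  | bot => simp
  | coe m => simp only [WithBot.coe_lt_coe, WithBot.coe_le_coe]; omega

lemma lt_hi_iff {n : ℤ} : (n : WithTop ℤ) < d.hi ↔ ((n + 1 : ℤ) : WithTop ℤ) ≤ d.hi := by
  cases d.hi with
  | top => simp
  | coe m => simp only [WithTop.coe_lt_coe, WithTop.coe_le_coe]; omega

lemma lo_lt_zero : d.lo < ((0 : ℤ) : WithBot ℤ) := d.lo_neg

lemma zero_lt_hi : ((0 : ℤ) : WithTop ℤ) < d.hi := d.hi_pos

lemma lo_lt_of_lt {m n : ℤ} (hm : d.lo ≤ (m : WithBot ℤ)) (h : m < n) : d.lo < (n : WithBot ℤ) :=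
  hm.trans_lt (WithBot.coe_lt_coe.2 h)

lemma lt_hi_of_lt {m n : ℤ} (hn : (n : WithTop ℤ) ≤ d.hi) (h : m < n) : (m : WithTop ℤ) < d.hi :=
  (WithTop.coe_lt_coe.2 h).trans_le hn

lemma exists_knot_eq {n : ℤ} (h1 : d.lo < (n : WithBot ℤ)) (h2 : (n : WithTop ℤ) ≤ d.hi) :
    ∃ m ∈ decompIndex d.lo d.hi, d.knot n = d.a m ∧ m = if 1 ≤ n then n else n - 1 := by
  by_cases h : 1 ≤ n
  · exact ⟨n, ⟨by omega, h1.le, h2⟩, by simp [knot, h], by simp [h]⟩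
  · exact ⟨n - 1, ⟨by omega, d.lo_lt_iff.1 h1, (d.lt_hi_of_lt h2 (by omega)).le⟩,
      by simp [knot, h], by simp [h]⟩

lemma knot_mem {n : ℤ} (h1 : d.lo < (n : WithBot ℤ))
    (h2 : (n : WithTop ℤ) ≤ d.hi) : d.knot n ∈ I := by
  obtain ⟨m, hm, h, -⟩ := d.exists_knot_eq h1 h2
  rw [h]
  exact interior_subset (d.mem_interior m hm)

lemma knot_lt {m n : ℤ} (h1 : d.lo < (m : WithBot ℤ)) (h2 : (n : WithTop ℤ) ≤ d.hi)
    (hmn : m < n) : d.knot m < d.knot n := by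
  obtain ⟨m', hm', h3, h3'⟩ := d.exists_knot_eq h1 (d.lt_hi_of_lt h2 hmn).le
  obtain ⟨n', hn', h4, h4'⟩ := d.exists_knot_eq (d.lo_lt_of_lt h1.le hmn) h2
  rw [h3, h4]
  refine d.strictMono hm' hn' ?_
  split_ifs at h3' h4' <;> omega

lemma knot_le {m n : ℤ} (h1 : d.lo < (m : WithBot ℤ)) (h2 : (n : WithTop ℤ) ≤ d.hi)
    (hmn : m ≤ n) : d.knot m ≤ d.knot n := by
  rcases hmn.lt_or_eq with h | rfl
  · exact (d.knot_lt h1 h2 h).le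
  · rfl

lemma piece_of_lt {n : ℤ} (h1 : d.lo < (n : WithBot ℤ)) (h2 : (n : WithTop ℤ) < d.hi) :
    d.piece n = Icc (d.knot n) (d.knot (n + 1)) := by
  rcases lt_trichotomy n 0 with h | rfl | h
  · rw [piece, if_neg h.ne, if_pos h, if_pos h1, knot, if_neg (by omega), knot,
      if_neg (by omega), add_sub_cancel_right]
  · simp [piece, knot]
  · rw [piece, if_neg h.ne', if_neg (by omega), if_pos h2, knot, if_pos (by omega), knot,
      if_pos (by omega)]

lemma piece_of_not_lo {n : ℤ} (h0 : n < 0) (h1 : ¬ d.lo < (n : WithBot ℤ)) :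
    d.piece n = I ∩ Iic (d.knot (n + 1)) := by
  rw [piece, if_neg h0.ne, if_pos h0, if_neg h1, knot, if_neg (by omega), add_sub_cancel_right]

lemma piece_of_not_hi {n : ℤ} (h0 : 0 < n) (h1 : ¬ (n : WithTop ℤ) < d.hi) :
    d.piece n = I ∩ Ici (d.knot n) := by
  rw [piece, if_neg h0.ne', if_neg (by omega), if_neg h1, knot, if_pos (by omega)]

/-- The piece `n` is cut out of `I` by its knots, as far as these exist. This treats compact and
half-open pieces uniformly. -/
lemma mem_piece_iff (hI : IsOpenInterval I) {n : ℤ} (h1 : d.lo ≤ (n : WithBot ℤ)) {t : ℝ} :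
    t ∈ d.piece n ↔
      t ∈ I ∧ (d.lo < (n : WithBot ℤ) → d.knot n ≤ t) ∧
        ((n : WithTop ℤ) < d.hi → t ≤ d.knot (n + 1)) := by
  by_cases hl : d.lo < (n : WithBot ℤ)
  · by_cases hh : (n : WithTop ℤ) < d.hi
    · rw [d.piece_of_lt hl hh]
      refine ⟨fun ht => ⟨?_, fun _ => ht.1, fun _ => ht.2⟩, fun ht => ⟨ht.2.1 hl, ht.2.2 hh⟩⟩
      exact hI.1.1.out (d.knot_mem hl hh.le) (d.knot_mem
        (d.lo_lt_of_lt h1 (by omega)) (d.lt_hi_iff.1 hh)) ht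
    · have : 0 < n := by
        by_contra hn
        exact hh ((WithTop.coe_le_coe.2 (not_lt.1 hn)).trans_lt d.zero_lt_hi)
      rw [d.piece_of_not_hi this hh]
      exact ⟨fun ht => ⟨ht.1, fun _ => ht.2, fun h => absurd h hh⟩, fun ht => ⟨ht.1, ht.2.1 hl⟩⟩
  · have h0 : n < 0 := by
      by_contra hn
      exact hl (d.lo_lt_zero.trans_le (WithBot.coe_le_coe.2 (not_lt.1 hn)))
    have hh : (n : WithTop ℤ) < d.hi := (WithTop.coe_lt_coe.2 h0).trans d.zero_lt_hi
    rw [d.piece_of_not_lo h0 hl]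
    exact ⟨fun ht => ⟨ht.1, fun h => absurd h hl, fun _ => ht.2⟩, fun ht => ⟨ht.1, ht.2.2 hh⟩⟩

lemma piece_subset (hI : IsOpenInterval I) {n : ℤ} (h1 : d.lo ≤ (n : WithBot ℤ)) : d.piece n ⊆ I :=
  fun _ ht => ((d.mem_piece_iff hI h1).1 ht).1

lemma isLeast_piece (hI : IsOpenInterval I) {n : ℤ} (h1 : d.lo < (n : WithBot ℤ))
    (h2 : (n : WithTop ℤ) ≤ d.hi) : IsLeast (d.piece n) (d.knot n) := by
  refine ⟨(d.mem_piece_iff hI h1.le).2 ⟨d.knot_mem h1 h2, fun _ => le_rfl, fun h => ?_⟩,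
    fun t ht => ((d.mem_piece_iff hI h1.le).1 ht).2.1 h1⟩
  exact (d.knot_lt h1 (d.lt_hi_iff.1 h) (by omega)).le

lemma isGreatest_piece (hI : IsOpenInterval I) {n : ℤ} (h1 : d.lo ≤ (n : WithBot ℤ))
    (h2 : (n : WithTop ℤ) < d.hi) : IsGreatest (d.piece n) (d.knot (n + 1)) := by
  have h1' := d.lo_lt_of_lt h1 (by omega : n < n + 1)
  refine ⟨(d.mem_piece_iff hI h1).2 ⟨d.knot_mem h1' (d.lt_hi_iff.1 h2), fun h => ?_,
    fun _ => le_rfl⟩, fun t ht => ((d.mem_piece_iff hI h1).1 ht).2.2 h2⟩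
  exact (d.knot_lt h (d.lt_hi_iff.1 h2) (by omega)).le

lemma mem_interior_piece_iff (hI : IsOpenInterval I) {n : ℤ} (h1 : d.lo ≤ (n : WithBot ℤ)) {t : ℝ} :
    t ∈ interior (d.piece n) ↔
      t ∈ I ∧ (d.lo < (n : WithBot ℤ) → d.knot n < t) ∧
        ((n : WithTop ℤ) < d.hi → t < d.knot (n + 1)) := by
  have key : d.piece n = I ∩ ({t | d.lo < (n : WithBot ℤ) → d.knot n ≤ t} ∩
      {t | (n : WithTop ℤ) < d.hi → t ≤ d.knot (n + 1)}) := by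
    ext t; exact d.mem_piece_iff hI h1
  rw [key, interior_inter, interior_inter, hI.2.interior_eq]
  have e1 : interior {t | d.lo < (n : WithBot ℤ) → d.knot n ≤ t}
      = {t | d.lo < (n : WithBot ℤ) → d.knot n < t} := by
    by_cases hl : d.lo < (n : WithBot ℤ)
    · simp only [hl, true_imp_iff]; exact interior_Ici
    · simp [hl]
  have e2 : interior {t | (n : WithTop ℤ) < d.hi → t ≤ d.knot (n + 1)}
      = {t | (n : WithTop ℤ) < d.hi → t < d.knot (n + 1)} := by
    by_cases hl : (n : WithTop ℤ) < d.hi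
    · simp only [hl, true_imp_iff]; exact interior_Iic
    · simp [hl]
  rw [e1, e2]
  rfl

end IntervalDecomp

/-! ### Decompositions of a positive interval -/

section Decompositions

lemma isOpenInterval_univ : IsOpenInterval (univ : Set ℝ) :=
  ⟨⟨ordConnected_univ, by simp⟩, isOpen_univ⟩

lemma PosRel.refl {M : Type*} (γ : ℝ → M) {α β : ℝ} (hαβ : α < β) :
    PosRel γ α β γ (Icc α β) := by
  refine Or.inl ⟨α, isLeast_Icc hαβ.le, left_mem_Icc.2 hαβ.le, left_mem_Icc.2 hαβ.le, id,
    ⟨image_id _, univ, univ, id, id, isOpenInterval_univ, isOpenInterval_univ, subset_univ _,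
      fun _ _ => rfl, mapsTo_univ _ _, mapsTo_univ _ _, ⟨fun _ _ => rfl, fun _ _ => rfl⟩,
      analyticOnNhd_id, analyticOnNhd_id⟩, rfl, fun _ _ => rfl⟩

lemma ReparamOn.eq_Icc {M : Type*} {δ γ : ℝ → M} {α β ε : ℝ} {P D U : Set ℝ} {τ : ℝ → ℝ}
    (h : ReparamOn δ α β γ P ε D U τ) (hα : α ∈ D) (hβ : β ∈ D) : D = Icc α β := by
  rcases h.shape with h | ⟨j, h1, h2, rfl⟩ | ⟨j, h1, h2, rfl⟩
  · exact h
  · exact absurd hβ.2 (not_lt.2 h2)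
  · exact absurd hα.1 (not_lt.2 h1)

variable {G : Type*} [Group G]
  {E : Type*} [NormedAddCommGroup E] [NormedSpace ℝ E]
  {M : Type*} [TopologicalSpace M] [ChartedSpace E M] [MulAction G M]
  {γ : ℝ → M} {I : Set ℝ} {α β : ℝ} {h : G}

namespace IsADecomp

variable {d : IntervalDecomp I} {g : ℤ → G}

lemma knot_zero (hd : IsADecomp E γ I α β d g) : d.knot 0 = α := by
  simpa [IntervalDecomp.knot] using hd.2.1

lemma knot_one (hd : IsADecomp E γ I α β d g) : d.knot 1 = β := by
  simpa [IntervalDecomp.knot] using hd.2.2.1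

lemma piece_zero (hd : IsADecomp E γ I α β d g) : d.piece 0 = Icc α β := by
  rw [d.piece_of_lt d.lo_lt_zero d.zero_lt_hi, zero_add, hd.knot_zero, hd.knot_one]

end IsADecomp

variable [FiniteDimensional ℝ E]

/-- Satedness excludes that translates of a whole curve segment shrink to a point. -/
lemma IsSatedAction.not_tendsto (hsated : IsSatedAction G M) (H : IsShift E γ I α β h) {x : ℝ}
    {u : ℕ → G} (hu : ∀ y ∈ Icc α β, Tendsto (fun n => u n • γ y) atTop (𝓝 (γ x))) : False := by
  obtain ⟨ε, hε, hinj⟩ := (H.immersiveAt α H.left_mem).exists_injOn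
  have hlt : α < min β (α + ε) := lt_min H.lt (by linarith)
  have hinf : (γ '' Ioo α (min β (α + ε))).Infinite :=
    (Ioo_infinite hlt).image (hinj.mono
      (Ioo_subset_Ioo (by linarith) (min_le_right _ _)))
  obtain ⟨_, ⟨⟨y, hy, rfl⟩, hyx⟩, _, ⟨⟨z, hz, rfl⟩, hzx⟩, hyz⟩ :=
    (hinf.sdiff (finite_singleton (γ x))).nontrivial
  have hmem : Ioo α (min β (α + ε)) ⊆ Icc α β := fun y hy =>
    ⟨hy.1.le, (hy.2.trans_le (min_le_left _ _)).le⟩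
  exact hsated (γ x) (γ y) (γ z) hyx hzx hyz ⟨u, hu y (hmem hy), hu z (hmem hz)⟩

variable [T2Space M]

namespace IsADecomp

variable {d : IntervalDecomp I} {g : ℤ → G}

/-- In any decomposition of an interval that admits a shift `h`, the piece `n` is the translate by
`h ^ n`, with the orientation preserved. This propagates from piece to piece: at the common end
point, a translate of `γ|_[α, β]` and its image under the shift fit together. -/
lemma posRel_zpow (H : IsShift E γ I α β h) (hd : IsADecomp E γ I α β d g) {n : ℤ}
    (h1 : d.lo ≤ (n : WithBot ℤ)) (h2 : (n : WithTop ℤ) ≤ d.hi) :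
    (n ≠ 0 → (h ^ n)⁻¹ * g n ∈ curveStabilizer G γ I) ∧
      PosRel (fun t => h ^ n • γ t) α β γ (d.piece n) := by
  have hI := H.isOpenInterval
  have base : PosRel (fun t => h ^ (0 : ℤ) • γ t) α β γ (d.piece 0) := by
    simpa [hd.piece_zero] using PosRel.refl γ H.lt
  rcases le_total 0 n with hn | hn
  · clear h1
    induction n, hn using Int.leInduction with
    | base => exact ⟨fun h => absurd rfl h, base⟩
    | succ n hn ih =>
      have hlo : d.lo < (n : WithBot ℤ) := d.lo_lt_zero.trans_le (WithBot.coe_le_coe.2 hn)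
      have hhi : (n : WithTop ℤ) < d.hi := d.lt_hi_iff.2 h2
      have hlo' := d.lo_lt_of_lt hlo.le (by omega : n < n + 1)
      obtain ⟨D, U, τ, hr⟩ := (ih hhi.le).2.exists_reparam H.lt
      obtain ⟨hβ, hτ⟩ := hr.right_of_isGreatest (d.isGreatest_piece hI hlo.le hhi)
      have h3 := hr.germLift H.contMDiff_smul H.immersiveAt H.lt H.subset
        (d.piece_subset hI hlo.le) hβ
      rw [hτ] at h3
      have h4 := H.germ.comp h3
      rw [one_mul, ← zpow_add_one] at h4
      have h5 := H.posRel_of_isLeast h4 (d.piece_subset hI hlo'.le) (d.isLeast_piece hI hlo' h2)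
        (hd.2.2.2.2.2 _ ⟨by omega, hlo'.le, h2⟩)
      exact ⟨fun _ => h5.1, h5.2⟩
  · clear h2
    induction n, hn using Int.leInductionDown with
    | base => exact ⟨fun h => absurd rfl h, base⟩
    | pred n hn ih =>
      have hhi : (n : WithTop ℤ) < d.hi := (WithTop.coe_le_coe.2 hn).trans_lt d.zero_lt_hi
      have hlo : d.lo < (n : WithBot ℤ) := d.lo_lt_iff.2 h1
      have hhi' := d.lt_hi_of_lt hhi.le (by omega : n - 1 < n)
      obtain ⟨D, U, τ, hr⟩ := (ih hlo.le).2.exists_reparam H.lt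
      obtain ⟨hα, hτ⟩ := hr.left_of_isLeast (d.isLeast_piece hI hlo hhi.le)
      have h3 := hr.germLift H.contMDiff_smul H.immersiveAt H.lt H.subset
        (d.piece_subset hI hlo.le) hα
      rw [hτ] at h3
      have h4 := H.germ.symm.comp h3
      rw [one_mul, ← zpow_sub_one] at h4
      have h6 := d.isGreatest_piece hI h1 hhi'
      rw [sub_add_cancel] at h6
      have h5 := H.posRel_of_isGreatest h4 (d.piece_subset hI h1) h6
        (hd.2.2.2.2.2 _ ⟨by omega, h1, hhi'.le⟩)
      exact ⟨fun _ => h5.1, h5.2⟩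

end IsADecomp

lemma IsPositiveInterval.exists_isShift
    (hM : ∀ g : G, ContMDiff 𝓘(ℝ, E) 𝓘(ℝ, E) ω (fun x : M => g • x))
    (hI : IsOpenInterval I) (hγ : ∀ t ∈ I, ImmersiveAt E γ t)
    (hpos : IsPositiveInterval G E γ I α β) : ∃ h : G, IsShift E γ I α β h := by
  obtain ⟨d, g, hd, hp, -⟩ := hpos
  have h0 := d.lo_lt_zero
  have h1 : ((1 : ℤ) : WithTop ℤ) ≤ d.hi := d.lt_hi_iff.1 d.zero_lt_hi
  have h2 := d.lo_lt_of_lt h0.le (by omega : (0 : ℤ) < 1)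
  have hlt : α < β := by
    rw [← hd.knot_zero, ← hd.knot_one]
    exact d.knot_lt h0 h1 (by omega)
  have hsub : Icc α β ⊆ I := by
    rw [← hd.piece_zero]; exact d.piece_subset hI h0.le
  refine ⟨g 1, hM, hI, hγ, hlt, hsub, hd.1, ?_, curveClass_ne_one_iff.1 hd.2.2.2.1⟩
  obtain ⟨D, U, τ, hr⟩ := hp.exists_reparam hlt
  obtain ⟨hα, hτ⟩ := hr.left_of_isLeast (d.isLeast_piece hI h2 h1)
  have h3 := hr.germLift hM hγ hlt hsub (d.piece_subset hI h2.le) hα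
  rwa [hτ, hd.knot_one] at h3

namespace IsADecomp

variable {d : IntervalDecomp I} {g : ℤ → G}

/-- Each piece is identified with a part of `[α, β]` by an increasing map `r`, through which `γ` is
the translate by `h ^ n`. -/
lemma exists_coord (H : IsShift E γ I α β h) (hd : IsADecomp E γ I α β d g) {n : ℤ}
    (h1 : d.lo ≤ (n : WithBot ℤ)) (h2 : (n : WithTop ℤ) ≤ d.hi) :
    ∃ r : ℝ → ℝ, ContinuousOn r (d.piece n) ∧ StrictMonoOn r (d.piece n) ∧
      MapsTo r (d.piece n) (Icc α β) ∧ (∀ t ∈ d.piece n, γ t = h ^ n • γ (r t)) ∧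
      (d.lo < (n : WithBot ℤ) → r (d.knot n) = α) ∧
      ((n : WithTop ℤ) < d.hi → r (d.knot (n + 1)) = β) := by
  obtain ⟨D, U, τ, hr⟩ := (hd.posRel_zpow H h1 h2).2.exists_reparam H.lt
  obtain ⟨σ, hσ, hσ'⟩ := hr.exists_inv
  refine ⟨σ, hσ, ?_, ?_, ?_, fun h => ?_, fun h => ?_⟩
  · rw [← hr.image]
    rintro _ ⟨x, hx, rfl⟩ _ ⟨y, hy, rfl⟩ hxy
    rw [hσ' x hx, hσ' y hy]
    have := hr.le_iff hy hx
    by_contra hc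
    linarith [this.2 (not_lt.1 hc)]
  · rw [← hr.image]
    rintro _ ⟨x, hx, rfl⟩
    rw [hσ' x hx]
    exact hr.subset_Icc hx
  · rw [← hr.image]
    rintro _ ⟨x, hx, rfl⟩
    rw [hσ' x hx]
    exact (hr.eq x hx).symm
  · obtain ⟨hα, hτ⟩ := hr.left_of_isLeast (d.isLeast_piece H.isOpenInterval h h2)
    rw [← hτ, hσ' _ hα]
  · obtain ⟨hβ, hτ⟩ := hr.right_of_isGreatest (d.isGreatest_piece H.isOpenInterval h1 h)
    rw [← hτ, hσ' _ hβ]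

lemma exists_smul_eq (H : IsShift E γ I α β h) (hd : IsADecomp E γ I α β d g) {n : ℤ}
    (h1 : d.lo < (n : WithBot ℤ)) (h2 : (n : WithTop ℤ) < d.hi) {y : ℝ} (hy : y ∈ Icc α β) :
    ∃ t ∈ Icc (d.knot n) (d.knot (n + 1)), h ^ n • γ y = γ t := by
  obtain ⟨D, U, τ, hr⟩ := (hd.posRel_zpow H h1.le h2.le).2.exists_reparam H.lt
  have hD := hr.eq_Icc (hr.left_of_isLeast (d.isLeast_piece H.isOpenInterval h1 h2.le)).1
    (hr.right_of_isGreatest (d.isGreatest_piece H.isOpenInterval h1.le h2)).1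
  have hy' : y ∈ D := by rwa [hD]
  refine ⟨τ y, ?_, hr.eq y hy'⟩
  rw [← d.piece_of_lt h1 h2, ← hr.image]
  exact mem_image_of_mem τ hy'

/-- The pieces of a decomposition cover the curve: their end points cannot accumulate inside,
because of satedness. -/
lemma exists_mem_piece (hsated : IsSatedAction G M) (H : IsShift E γ I α β h)
    (hd : IsADecomp E γ I α β d g) {t : ℝ} (ht : t ∈ I) :
    ∃ n : ℤ, d.lo ≤ (n : WithBot ℤ) ∧ (n : WithTop ℤ) ≤ d.hi ∧ t ∈ d.piece n := by
  by_contra! hcon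
  have hI := H.isOpenInterval
  rcases le_total α t with hαt | hαt
  · have key : ∀ n : ℕ, ((n : ℤ) : WithTop ℤ) ≤ d.hi ∧ d.knot n ≤ t := by
      intro n
      induction n with
      | zero => exact ⟨d.zero_lt_hi.le, by simpa [hd.knot_zero] using hαt⟩
      | succ n ih =>
        have hlo : d.lo < ((n : ℤ) : WithBot ℤ) :=
          d.lo_lt_zero.trans_le (WithBot.coe_le_coe.2 (by omega))
        have := hcon n hlo.le ih.1
        rw [d.mem_piece_iff hI hlo.le] at this
        push Not at this
        obtain ⟨h3, h4⟩ := this ht fun _ => ih.2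
        exact ⟨d.lt_hi_iff.1 h3, h4.le⟩
    have hlo : ∀ n : ℕ, d.lo < ((n : ℤ) : WithBot ℤ) := fun n =>
      d.lo_lt_zero.trans_le (WithBot.coe_le_coe.2 (by omega))
    have hmono : Monotone fun n : ℕ => d.knot n := fun m n hmn =>
      d.knot_le (hlo m) (key n).1 (by omega)
    have hlim := tendsto_atTop_ciSup hmono ⟨t, by rintro _ ⟨n, rfl⟩; exact (key n).2⟩
    set x := ⨆ n : ℕ, d.knot n
    have hx : x ∈ I := by
      refine hI.1.1.out H.left_mem ht ⟨?_, le_of_tendsto' hlim fun n => (key n).2⟩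
      refine ge_of_tendsto' hlim fun n => ?_
      rw [← hd.knot_zero]
      exact d.knot_le d.lo_lt_zero (key n).1 (by omega)
    refine hsated.not_tendsto H (x := x) (u := fun n => h ^ (n : ℤ)) fun y hy => ?_
    have hhi : ∀ n : ℕ, ((n : ℤ) : WithTop ℤ) < d.hi := fun n => by
      rw [d.lt_hi_iff]; exact_mod_cast (key (n + 1)).1
    choose s hs hs' using fun n : ℕ => hd.exists_smul_eq H (hlo n) (hhi n) hy
    have hs2 : Tendsto s atTop (𝓝 x) := by
      refine tendsto_of_tendsto_of_tendsto_of_le_of_le hlim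
        ((tendsto_add_atTop_iff_nat 1).2 hlim) (fun n => (hs n).1) (fun n => ?_)
      simpa using (hs n).2
    have := (H.immersiveAt x hx).continuousAt.tendsto.comp hs2
    exact this.congr fun n => (hs' n).symm
  · have key : ∀ n : ℕ, d.lo < ((-n : ℤ) : WithBot ℤ) ∧ t ≤ d.knot (-n) := by
      intro n
      induction n with
      | zero => exact ⟨by simpa using d.lo_lt_zero, by simpa [hd.knot_zero] using hαt⟩
      | succ n ih =>
        have hlo : d.lo ≤ ((-(n + 1 : ℕ) : ℤ) : WithBot ℤ) := by
          have := d.lo_lt_iff.1 ih.1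
          rwa [show (-(n : ℤ) - 1) = (-(n + 1 : ℕ) : ℤ) by push_cast; ring] at this
        have hhi : ((-(n + 1 : ℕ) : ℤ) : WithTop ℤ) ≤ d.hi :=
          ((WithTop.coe_le_coe.2 (by omega)).trans_lt d.zero_lt_hi).le
        have := hcon _ hlo hhi
        rw [d.mem_piece_iff hI hlo] at this
        by_contra hc
        refine this ⟨ht, fun h3 => ?_, fun _ => ?_⟩
        · by_contra h4
          exact hc ⟨h3, (not_le.1 h4).le⟩
        · rw [show (-(n + 1 : ℕ) : ℤ) + 1 = -n by push_cast; ring]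
          exact ih.2
    have hhi : ∀ n : ℕ, ((-n : ℤ) : WithTop ℤ) < d.hi := fun n =>
      (WithTop.coe_le_coe.2 (by omega)).trans_lt d.zero_lt_hi
    have hmono : Antitone fun n : ℕ => d.knot (-n) := fun m n hmn =>
      d.knot_le (key n).1 (hhi m).le (by omega)
    have hlim := tendsto_atTop_ciInf hmono ⟨t, by rintro _ ⟨n, rfl⟩; exact (key n).2⟩
    set x := ⨅ n : ℕ, d.knot (-n)
    have hx : x ∈ I := by
      refine hI.1.1.out ht H.left_mem ⟨ge_of_tendsto' hlim fun n => (key n).2, ?_⟩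
      refine le_of_tendsto' hlim fun n => ?_
      rw [← hd.knot_zero]
      exact d.knot_le (key n).1 d.zero_lt_hi.le (by omega)
    refine hsated.not_tendsto H (x := x) (u := fun n => h ^ (-(n + 1 : ℕ) : ℤ)) fun y hy => ?_
    choose s hs hs' using fun n : ℕ => hd.exists_smul_eq H (key (n + 1)).1 (hhi (n + 1)) hy
    have hs2 : Tendsto s atTop (𝓝 x) := by
      refine tendsto_of_tendsto_of_tendsto_of_le_of_le
        ((tendsto_add_atTop_iff_nat 1).2 hlim) hlim (fun n => (hs n).1) (fun n => ?_)
      have := (hs n).2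
      rwa [show (-(n + 1 : ℕ) : ℤ) + 1 = -n by push_cast; ring] at this
    have := (H.immersiveAt x hx).continuousAt.tendsto.comp hs2
    exact this.congr fun n => (hs' n).symm

end IsADecomp

end Decompositions

/-! ### The coordinate attached to a decomposition -/

section Development

variable {G : Type*} [Group G]
  {E : Type*} [NormedAddCommGroup E] [NormedSpace ℝ E]
  {M : Type*} [TopologicalSpace M] [ChartedSpace E M] [MulAction G M]
  {γ : ℝ → M} {I : Set ℝ} {α β : ℝ} {h : G} {u : ℝ → ℝ}

/-- A development: a coordinate `u` on `I`, with `α` at `0` and `β` at `1`, in which `h` acts on `γ` as the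
translation by `1`. The coordinate is only required to be continuous, as translations of it are
analytic in the original parameter anyway. -/
structure IsDevelopment (γ : ℝ → M) (I : Set ℝ) (α β : ℝ) (h : G) (u : ℝ → ℝ) : Prop where
  strictMonoOn : StrictMonoOn u I
  continuousOn : ContinuousOn u I
  smul_eq : ∀ s ∈ I, ∀ t ∈ I, ∀ k : ℤ, u t = u s + k → γ t = h ^ k • γ s
  left : u α = 0
  right : u β = 1

/-- A decomposition gives rise to a development, in which the pieces are intervals between
consecutive integers. -/
lemma IsADecomp.exists_isDevelopment [FiniteDimensional ℝ E] [T2Space M]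
    {d : IntervalDecomp I} {g : ℤ → G} (hsated : IsSatedAction G M)
    (H : IsShift E γ I α β h) (hd : IsADecomp E γ I α β d g) :
    ∃ u : ℝ → ℝ, IsDevelopment γ I α β h u ∧
      (∀ n : ℤ, d.lo ≤ (n : WithBot ℤ) → (n : WithTop ℤ) ≤ d.hi →
        ∀ t ∈ d.piece n, (n : ℝ) ≤ u t ∧ u t ≤ n + 1) ∧
      (∀ n : ℤ, d.lo < (n : WithBot ℤ) → (n : WithTop ℤ) ≤ d.hi → u (d.knot n) = n) := by
  have hI := H.isOpenInterval
  have hβα : 0 < β - α := sub_pos.2 H.lt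
  have hcoord : ∀ n : ℤ, d.lo ≤ (n : WithBot ℤ) ∧ (n : WithTop ℤ) ≤ d.hi → ∃ w : ℝ → ℝ,
      ContinuousOn w (d.piece n) ∧ StrictMonoOn w (d.piece n) ∧
      (∀ t ∈ d.piece n, 0 ≤ w t ∧ w t ≤ 1) ∧
      (∀ t ∈ d.piece n, γ t = h ^ n • γ (α + w t * (β - α))) ∧
      (d.lo < (n : WithBot ℤ) → w (d.knot n) = 0) ∧
      ((n : WithTop ℤ) < d.hi → w (d.knot (n + 1)) = 1) := by
    rintro n ⟨h1, h2⟩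
    obtain ⟨r, hr1, hr2, hr3, hr4, hr5, hr6⟩ := hd.exists_coord H h1 h2
    refine ⟨fun t => (r t - α) / (β - α), (hr1.sub continuousOn_const).div_const _, ?_, ?_, ?_,
      fun h => by simp [hr5 h], fun h => by simp [hr6 h, hβα.ne']⟩
    · intro s hs t ht hst
      have := hr2 hs ht hst
      simp only
      gcongr
    · intro t ht
      have := hr3 ht
      exact ⟨div_nonneg (by linarith [this.1]) hβα.le,
        (div_le_one hβα).2 (by linarith [this.2])⟩
    · intro t ht
      rw [hr4 t ht, div_mul_cancel₀ _ hβα.ne', add_sub_cancel]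
  choose! w hwc hwm hw01 hwγ hw0 hw1 using hcoord
  have key : ∀ m n : ℤ, d.lo ≤ (m : WithBot ℤ) → (m : WithTop ℤ) ≤ d.hi →
      d.lo ≤ (n : WithBot ℤ) → (n : WithTop ℤ) ≤ d.hi → ∀ s ∈ d.piece m, ∀ t ∈ d.piece n,
      (s ≤ t → m + w m s ≤ n + w n t) ∧ (s < t → m + w m s < n + w n t) := by
    intro m n hm1 hm2 hn1 hn2 s hs t ht
    obtain ⟨s0, s1⟩ := hw01 m ⟨hm1, hm2⟩ s hs
    obtain ⟨t0, t1⟩ := hw01 n ⟨hn1, hn2⟩ t ht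
    rcases lt_trichotomy m n with hmn | rfl | hmn
    · have hm3 := d.lt_hi_of_lt hn2 hmn
      have hn3 := d.lo_lt_of_lt hm1 hmn
      have e1 := (d.isGreatest_piece hI hm1 hm3).2 hs
      have e2 := (d.isLeast_piece hI hn3 hn2).2 ht
      have hmn' : (m : ℝ) + 1 ≤ n := by exact_mod_cast hmn
      refine ⟨fun _ => by linarith, fun hst => ?_⟩
      by_contra hc
      have : (m : ℝ) + 1 = n := by linarith
      have hmn2 : m + 1 = n := by exact_mod_cast this
      subst hmn2
      have e3 : s = d.knot (m + 1) := (hwm m ⟨hm1, hm2⟩).injOn hs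
        (d.isGreatest_piece hI hm1 hm3).1 (by rw [hw1 m ⟨hm1, hm2⟩ hm3]; linarith)
      have e4 : t = d.knot (m + 1) := (hwm _ ⟨hn1, hn2⟩).injOn ht
        (d.isLeast_piece hI hn3 hn2).1 (by rw [hw0 _ ⟨hn1, hn2⟩ hn3]; linarith)
      linarith
    · refine ⟨fun hst => ?_, fun hst => ?_⟩
      · have := (hwm m ⟨hm1, hm2⟩).monotoneOn hs ht hst
        linarith
      · have := hwm m ⟨hm1, hm2⟩ hs ht hst
        linarith
    · have hn3 := d.lt_hi_of_lt hm2 hmn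
      have hm3 := d.lo_lt_of_lt hn1 hmn
      have e1 := (d.isGreatest_piece hI hn1 hn3).2 ht
      have e2 := (d.isLeast_piece hI hm3 hm2).2 hs
      have e3 : d.knot (n + 1) ≤ d.knot m :=
        d.knot_le (d.lo_lt_of_lt hn1 (by omega)) hm2 (by omega)
      refine ⟨fun hst => ?_, fun hst => by linarith⟩
      have hnm : m = n + 1 := by
        by_contra hne
        have := d.knot_lt (d.lo_lt_of_lt hn1 (by omega : n < n + 1)) hm2 (by omega)
        linarith
      subst hnm
      have e4 : s = d.knot (n + 1) := by linarith
      have e5 : t = d.knot (n + 1) := by linarith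
      rw [e4, e5, hw0 _ ⟨hm1, hm2⟩ hm3, hw1 n ⟨hn1, hn2⟩ hn3]
      push_cast; linarith
  -- On the piece `n` the coordinate is `n + w n`; by `key` this is consistent at common end points.
  choose! N hN1 hN2 hN3 using fun t (ht : t ∈ I) => hd.exists_mem_piece hsated H ht
  set u : ℝ → ℝ := fun t => N t + w (N t) t with hu
  have huN : ∀ n : ℤ, d.lo ≤ (n : WithBot ℤ) → (n : WithTop ℤ) ≤ d.hi → ∀ t ∈ d.piece n,
      u t = n + w n t := by
    intro n h1 h2 t ht
    have htI := d.piece_subset hI h1 ht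
    exact le_antisymm
      ((key _ _ (hN1 t htI) (hN2 t htI) h1 h2 t (hN3 t htI) t ht).1 le_rfl)
      ((key _ _ h1 h2 (hN1 t htI) (hN2 t htI) t ht t (hN3 t htI)).1 le_rfl)
  have hknot : ∀ n : ℤ, d.lo < (n : WithBot ℤ) → (n : WithTop ℤ) ≤ d.hi →
      u (d.knot n) = n := by
    intro n h1 h2
    rw [huN n h1.le h2 _ (d.isLeast_piece hI h1 h2).1, hw0 n ⟨h1.le, h2⟩ h1, add_zero]
  have hcN : ∀ n : ℤ, d.lo ≤ (n : WithBot ℤ) → (n : WithTop ℤ) ≤ d.hi →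
      ContinuousOn u (d.piece n) := fun n h1 h2 =>
    (continuousOn_const.add (hwc n ⟨h1, h2⟩)).congr (huN n h1 h2)
  refine ⟨u, ⟨?_, ?_, ?_, ?_, ?_⟩, ?_, hknot⟩
  · intro s hs t ht hst
    exact (key _ _ (hN1 s hs) (hN2 s hs) (hN1 t ht) (hN2 t ht) s (hN3 s hs) t (hN3 t ht)).2 hst
  · refine fun t ht => ContinuousAt.continuousWithinAt ?_
    -- Two neighbouring pieces together are a neighbourhood of their common end point.
    have hk : ∀ m : ℤ, d.lo < (m : WithBot ℤ) → (m : WithTop ℤ) ≤ d.hi →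
        ContinuousAt u (d.knot m) := by
      intro m h1 h2
      have h1' := d.lo_lt_iff.1 h1
      have h2' := d.lt_hi_of_lt h2 (by omega : m - 1 < m)
      have hInhds := hI.2.mem_nhds (d.knot_mem h1 h2)
      rw [continuousAt_iff_continuous_left_right]
      constructor
      · have hg := (d.isGreatest_piece hI h1' h2').1
        rw [sub_add_cancel] at hg
        refine (hcN (m - 1) h1' h2'.le _ hg).mono_of_mem_nhdsWithin ?_
        have hev : ∀ᶠ s in 𝓝 (d.knot m), d.lo < ((m - 1 : ℤ) : WithBot ℤ) → d.knot (m - 1) ≤ s := by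
          by_cases h3 : d.lo < ((m - 1 : ℤ) : WithBot ℤ)
          · filter_upwards [lt_mem_nhds (d.knot_lt h3 h2 (by omega : m - 1 < m))] with s hs _
            exact hs.le
          · exact Eventually.of_forall fun s h => absurd h h3
        filter_upwards [nhdsWithin_le_nhds hInhds, nhdsWithin_le_nhds hev, self_mem_nhdsWithin]
          with s hs1 hs2 hs3
        refine (d.mem_piece_iff hI h1').2 ⟨hs1, hs2, fun _ => ?_⟩
        rw [sub_add_cancel]; exact hs3
      · refine (hcN m h1.le h2 _ (d.isLeast_piece hI h1 h2).1).mono_of_mem_nhdsWithin ?_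
        have hev : ∀ᶠ s in 𝓝 (d.knot m), (m : WithTop ℤ) < d.hi → s ≤ d.knot (m + 1) := by
          by_cases h3 : (m : WithTop ℤ) < d.hi
          · filter_upwards [gt_mem_nhds (d.knot_lt h1 (d.lt_hi_iff.1 h3) (by omega : m < m + 1))]
              with s hs _
            exact hs.le
          · exact Eventually.of_forall fun s h => absurd h h3
        filter_upwards [nhdsWithin_le_nhds hInhds, nhdsWithin_le_nhds hev, self_mem_nhdsWithin]
          with s hs1 hs2 hs3
        exact (d.mem_piece_iff hI h1.le).2 ⟨hs1, fun _ => hs3, hs2⟩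
    obtain ⟨n, hn1, hn2, hn3⟩ := hd.exists_mem_piece hsated H ht
    by_cases hint : t ∈ interior (d.piece n)
    · exact (hcN n hn1 hn2).continuousAt (mem_interior_iff_mem_nhds.1 hint)
    rw [d.mem_interior_piece_iff hI hn1] at hint
    rw [d.mem_piece_iff hI hn1] at hn3
    by_cases hl : d.lo < (n : WithBot ℤ) → d.knot n < t
    · by_cases hh : (n : WithTop ℤ) < d.hi → t < d.knot (n + 1)
      · exact absurd ⟨ht, hl, hh⟩ hint
      · push Not at hh
        rw [le_antisymm (hn3.2.2 hh.1) hh.2]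
        exact hk _ (d.lo_lt_of_lt hn1 (by omega)) (d.lt_hi_iff.1 hh.1)
    · push Not at hl
      rw [le_antisymm hl.2 (hn3.2.1 hl.1)]
      exact hk _ hl.1 hn2
  · intro s hs t ht k hst
    have hs' := hN3 s hs
    have ht' := hN3 t ht
    obtain ⟨s0, s1⟩ := hw01 _ ⟨hN1 s hs, hN2 s hs⟩ s hs'
    obtain ⟨t0, t1⟩ := hw01 _ ⟨hN1 t ht, hN2 t ht⟩ t ht'
    rw [hwγ _ ⟨hN1 s hs, hN2 s hs⟩ s hs', hwγ _ ⟨hN1 t ht, hN2 t ht⟩ t ht', smul_smul, ← zpow_add]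
    have hβ := H.germ.smul_eq
    simp only [hu] at hst
    generalize N s = m at *
    generalize N t = n at *
    obtain ⟨j, hj⟩ : ∃ j : ℤ, j = n - m - k := ⟨_, rfl⟩
    have hj' : (j : ℝ) = w m s - w n t := by rw [hj]; push_cast; linarith
    have j1 : j ≤ 1 := by have : (j : ℝ) ≤ 1 := by linarith
                          exact_mod_cast this
    have j2 : -1 ≤ j := by have : (-1 : ℝ) ≤ j := by linarith
                           exact_mod_cast this
    -- For `j = ±1` one of the points is the common end point of two pieces, where `γ β = h • γ α`
    -- relates the two descriptions.
    obtain rfl | rfl | rfl : j = 0 ∨ j = 1 ∨ j = -1 := by omega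
    · rw [show w m s = w n t by push_cast at hj'; linarith, show n = k + m by omega]
    · rw [show w m s = 1 by push_cast at hj'; linarith, show w n t = 0 by push_cast at hj'; linarith,
        show n = k + m + 1 by omega, zpow_add_one, mul_smul, zero_mul, add_zero, one_mul,
        add_sub_cancel, hβ]
    · rw [show w m s = 0 by push_cast at hj'; linarith, show w n t = 1 by push_cast at hj'; linarith,
        show k + m = n + 1 by omega, zpow_add_one, mul_smul, zero_mul, add_zero, one_mul,
        add_sub_cancel, hβ]
  · have := hknot 0 d.lo_lt_zero d.zero_lt_hi.le
    rwa [hd.knot_zero, Int.cast_zero] at this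
  · have := hknot 1 (d.lo_lt_of_lt d.lo_lt_zero.le (by omega)) (d.lt_hi_iff.1 d.zero_lt_hi)
    rwa [hd.knot_one, Int.cast_one] at this
  · intro n h1 h2 t ht
    rw [huN n h1 h2 t ht]
    obtain ⟨e1, e2⟩ := hw01 n ⟨h1, h2⟩ t ht
    exact ⟨by linarith, by linarith⟩

end Development

/-! ### Freeness and maximality of unit intervals -/

section Translations

variable {G : Type*} [Group G] {M : Type*} [MulAction G M]
  {γ : ℝ → M} {I : Set ℝ} {α β : ℝ} {h : G} {u : ℝ → ℝ}

lemma isOpen_image_of_strictMonoOn (hI : IsOpen I) (hu : StrictMonoOn u I)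
    (huc : ContinuousOn u I) : IsOpen (u '' I) := by
  rw [isOpen_iff_mem_nhds]
  rintro _ ⟨t, ht, rfl⟩
  obtain ⟨ε, hε, hb⟩ := Metric.nhds_basis_closedBall.mem_iff.1 (hI.mem_nhds ht)
  rw [Real.closedBall_eq_Icc] at hb
  have h1 : t - ε ∈ I := hb ⟨le_rfl, by linarith⟩
  have h2 : t + ε ∈ I := hb ⟨by linarith, le_rfl⟩
  refine mem_of_superset (Icc_mem_nhds (hu h1 ht (by linarith)) (hu ht h2 (by linarith))) ?_
  exact (intermediate_value_Icc (by linarith) (huc.mono hb)).trans (image_mono hb)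

/-- If `u (τ x) = u x + k` for a coordinate `u` that is continuous and strictly increasing, then
`τ` is continuous. -/
lemma continuousAt_of_coord_eq_add (hI : IsOpen I) (hu : StrictMonoOn u I) (huc : ContinuousOn u I)
    {τ : ℝ → ℝ} {k t : ℝ} (ht : t ∈ I) (hτt : τ t ∈ I)
    (hτ : ∀ᶠ x in 𝓝 t, τ x ∈ I ∧ u (τ x) = u x + k) : ContinuousAt τ t := by
  have hut := (huc.continuousAt (hI.mem_nhds ht))
  have h0 := hτ.self_of_nhds.2
  obtain ⟨ε₀, hε₀, hb₀⟩ := Metric.nhds_basis_closedBall.mem_iff.1 (hI.mem_nhds hτt)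
  rw [Metric.continuousAt_iff']
  intro ε hε
  set η := min ε₀ (ε / 2)
  have hη : 0 < η := lt_min hε₀ (by linarith)
  have hη2 : η < ε := (min_le_right _ _).trans_lt (by linarith)
  have hb : Icc (τ t - η) (τ t + η) ⊆ I := by
    rw [← Real.closedBall_eq_Icc]
    exact (Metric.closedBall_subset_closedBall (min_le_left _ _)).trans hb₀
  have h1 : τ t - η ∈ I := hb ⟨le_rfl, by linarith⟩
  have h2 : τ t + η ∈ I := hb ⟨by linarith, le_rfl⟩
  have e1 : ∀ᶠ x in 𝓝 t, u (τ t - η) < u x + k :=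
    continuousAt_const.eventually_lt (hut.add continuousAt_const)
      (by rw [← h0]; exact hu h1 hτt (by linarith))
  have e2 : ∀ᶠ x in 𝓝 t, u x + k < u (τ t + η) :=
    (hut.add continuousAt_const).eventually_lt continuousAt_const
      (show u t + k < _ by rw [← h0]; exact hu hτt h2 (by linarith))
  filter_upwards [hτ, e1, e2] with x hx hx1 hx2
  rw [← hx.2] at hx1 hx2
  have := (hu.lt_iff_lt h1 hx.1).1 hx1
  have := (hu.lt_iff_lt hx.1 h2).1 hx2
  rw [Real.dist_eq, abs_lt]
  constructor <;> linarith

namespace IsDevelopment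

lemma isOpen_image (hu : IsDevelopment γ I α β h u) (hI : IsOpenInterval I) : IsOpen (u '' I) :=
  isOpen_image_of_strictMonoOn hI.2 hu.strictMonoOn hu.continuousOn

lemma ordConnected_image (hu : IsDevelopment γ I α β h u) (hI : IsOpenInterval I) :
    (u '' I).OrdConnected :=
  (hI.1.1.isPreconnected.image u hu.continuousOn).ordConnected

lemma isOpen_dom (hu : IsDevelopment γ I α β h u) (hI : IsOpenInterval I) (k : ℝ) :
    IsOpen {s | s ∈ I ∧ u s + k ∈ u '' I} :=
  (hu.continuousOn.add continuousOn_const).isOpen_inter_preimage hI.2 (hu.isOpen_image hI)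

lemma isOpenInterval_dom (hu : IsDevelopment γ I α β h u) (hI : IsOpenInterval I) {k s : ℝ}
    (hs : s ∈ I) (hk : u s + k ∈ u '' I) : IsOpenInterval {s | s ∈ I ∧ u s + k ∈ u '' I} := by
  refine ⟨⟨⟨?_⟩, ?_⟩, hu.isOpen_dom hI k⟩
  · intro x hx y hy z hz
    have hzI := hI.1.1.out hx.1 hy.1 hz
    refine ⟨hzI, (hu.ordConnected_image hI).out hx.2 hy.2 ⟨?_, ?_⟩⟩
    · linarith [(hu.strictMonoOn.le_iff_le hx.1 hzI).2 hz.1]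
    · linarith [(hu.strictMonoOn.le_iff_le hzI hy.1).2 hz.2]
  · rw [(hu.isOpen_dom hI k).interior_eq]; exact ⟨s, hs, hk⟩

/-- A right inverse of the coordinate on its range. -/
lemma exists_inv (u : ℝ → ℝ) (I : Set ℝ) :
    ∃ v : ℝ → ℝ, ∀ y ∈ u '' I, v y ∈ I ∧ u (v y) = y := by
  choose! v hv using fun y (hy : y ∈ u '' I) => hy
  exact ⟨v, hv⟩

variable {E : Type*} [NormedAddCommGroup E] [NormedSpace ℝ E]
  [TopologicalSpace M] [ChartedSpace E M]

/-- A point whose coordinate is not an integer is a translate of an interior point of `[α, β]`. -/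
lemma exists_mem_Ioo (hu : IsDevelopment γ I α β h u) (H : IsShift E γ I α β h) {t : ℝ}
    (hn : ∀ n : ℤ, u t ≠ n) : ∃ s ∈ Ioo α β, u t = u s + ⌊u t⌋ := by
  have h1 : Int.fract (u t) ∈ Icc (u α) (u β) := by
    rw [hu.left, hu.right]; exact ⟨Int.fract_nonneg _, (Int.fract_lt_one _).le⟩
  obtain ⟨s, hs, hst⟩ := intermediate_value_Icc H.lt.le (hu.continuousOn.mono H.subset) h1
  refine ⟨s, ⟨lt_of_le_of_ne hs.1 ?_, lt_of_le_of_ne hs.2 ?_⟩, ?_⟩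
  · rintro rfl
    rw [hu.left] at hst
    exact hn ⌊u t⌋ (by rw [← Int.floor_add_fract (u t), ← hst]; simp)
  · rintro rfl
    rw [hu.right] at hst
    exact (Int.fract_lt_one _).ne hst.symm
  · rw [hst, add_comm]; exact (Int.floor_add_fract _).symm

variable [FiniteDimensional ℝ E]

/-- Translations of the coordinate are analytic in the original parameter. -/
lemma analyticAt_translation (hu : IsDevelopment γ I α β h u) (H : IsShift E γ I α β h) {k : ℤ}
    {τ : ℝ → ℝ} (hτ : ∀ s ∈ I, u s + k ∈ u '' I → τ s ∈ I ∧ u (τ s) = u s + k) {s : ℝ}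
    (hs : s ∈ I) (hk : u s + k ∈ u '' I) :
    AnalyticAt ℝ τ s ∧ ∀ᶠ x in 𝓝 s, γ (τ x) = h ^ k • γ x := by
  have hI := H.isOpenInterval
  have hev := (hu.isOpen_dom hI k).mem_nhds (⟨hs, hk⟩ : s ∈ {s | s ∈ I ∧ u s + k ∈ u '' I})
  have hc : ContinuousAt τ s := continuousAt_of_coord_eq_add hI.2 hu.strictMonoOn hu.continuousOn
    hs (hτ s hs hk).1 (by filter_upwards [hev] with x hx using hτ x hx.1 hx.2)
  have he : ∀ᶠ x in 𝓝 s, γ (τ x) = h ^ k • γ x := by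
    filter_upwards [hev] with x hx
    exact hu.smul_eq x hx.1 _ (hτ x hx.1 hx.2).1 k (hτ x hx.1 hx.2).2
  exact ⟨(H.immersiveAt _ (hτ s hs hk).1).analyticAt_lift
    ((H.immersiveAt s hs).smul H.contMDiff_smul _).1 hc he, he⟩

lemma germLift (hu : IsDevelopment γ I α β h u) (H : IsShift E γ I α β h) {s t : ℝ} {k : ℤ}
    (hs : s ∈ I) (ht : t ∈ I) (hst : u t = u s + k) : GermLift γ (h ^ k) 1 s t := by
  obtain ⟨v, hv⟩ := exists_inv u I
  have hτ : ∀ s ∈ I, u s + k ∈ u '' I → v (u s + k) ∈ I ∧ u (v (u s + k)) = u s + k :=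
    fun s _ h => hv _ h
  have hk : u s + k ∈ u '' I := ⟨t, ht, hst⟩
  obtain ⟨ha, he⟩ := hu.analyticAt_translation H (τ := fun x => v (u x + k)) hτ hs hk
  have hvt : v (u s + k) = t :=
    hu.strictMonoOn.injOn (hτ s hs hk).1 ht (by rw [(hτ s hs hk).2, hst])
  have hd := ((H.immersiveAt s hs).smul H.contMDiff_smul (h ^ k)).deriv_lift_ne_zero
    (H.immersiveAt _ (hτ s hs hk).1) ha.differentiableAt he
  refine ⟨fun x => v (u x + k), hvt, ha, ?_, he⟩
  have hsl := eventually_slope_pos ha.differentiableAt (mul_self_pos.2 hd)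
  have hdom := (hu.isOpen_dom H.isOpenInterval k).mem_nhds
    (⟨hs, hk⟩ : s ∈ {s | s ∈ I ∧ u s + k ∈ u '' I})
  obtain ⟨x, ⟨h1, h2⟩, h3⟩ := (((eventually_nhdsWithin_iff.1 hsl).and hdom).filter_mono
    (nhdsWithin_le_nhds (s := Ioi s)) |>.and self_mem_nhdsWithin).exists
  have h3' : s < x := h3
  have h4 : v (u s + k) < v (u x + k) := by
    rw [← hu.strictMonoOn.lt_iff_lt (hτ s hs hk).1 (hτ x h2.1 h2.2).1, (hτ s hs hk).2,
      (hτ x h2.1 h2.2).2]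
    linarith [hu.strictMonoOn hs h2.1 h3']
  have h5 := h1 (ne_of_gt h3')
  have h6 := (pos_iff_pos_of_mul_pos h5).2 (sub_pos.2 h3')
  rw [one_mul]
  exact (pos_iff_pos_of_mul_pos h6).2 (sub_pos.2 h4)

lemma relAt (hu : IsDevelopment γ I α β h u) (H : IsShift E γ I α β h) {k : ℤ} {D P : Set ℝ}
    (hD : D ⊆ I) (hP : P ⊆ I) (h1 : ∀ s ∈ D, ∃ t ∈ P, u t = u s + k)
    (h2 : ∀ t ∈ P, ∃ s ∈ D, u t = u s + k) {s t : ℝ} (hs : s ∈ D) (ht : t ∈ P)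
    (hst : u t = u s + k) : RelAt (fun x => h ^ k • γ x) D s γ P t := by
  obtain ⟨v, hv⟩ := exists_inv u I
  have hI := H.isOpenInterval
  have hinv : ∀ x ∈ I, v (u x) = x := fun x hx =>
    hu.strictMonoOn.injOn (hv _ (mem_image_of_mem u hx)).1 hx (hv _ (mem_image_of_mem u hx)).2
  have hvt : ∀ s ∈ D, ∀ t ∈ P, u t = u s + k → v (u s + k) = t := fun s _ t ht hst => by
    rw [← hst, hinv t (hP ht)]
  have hdom : ∀ s ∈ D, s ∈ {s | s ∈ I ∧ u s + k ∈ u '' I} := fun s hs => by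
    obtain ⟨t, ht, hst⟩ := h1 s hs
    exact ⟨hD hs, t, hP ht, hst⟩
  have hmaps : ∀ j : ℤ, MapsTo (fun x => v (u x + j)) {s | s ∈ I ∧ u s + j ∈ u '' I}
      {s | s ∈ I ∧ u s + (-j : ℤ) ∈ u '' I} := by
    rintro j x ⟨hx, hxj⟩
    refine ⟨(hv _ hxj).1, x, hx, ?_⟩
    rw [(hv _ hxj).2]; push_cast; ring
  have hleft : ∀ j : ℤ, LeftInvOn (fun x => v (u x + (-j : ℤ))) (fun x => v (u x + j))
      {s | s ∈ I ∧ u s + j ∈ u '' I} := by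
    rintro j x ⟨hx, hxj⟩
    simp only
    rw [(hv _ hxj).2, show u x + j + (-j : ℤ) = u x by push_cast; ring, hinv x hx]
  have hana : ∀ j : ℤ, AnalyticOnNhd ℝ (fun x => v (u x + j)) {s | s ∈ I ∧ u s + j ∈ u '' I} :=
    fun j x hx => (hu.analyticAt_translation H (fun s _ h => hv _ h) hx.1 hx.2).1
  have hm := hmaps (-k)
  have hl := hleft (-k)
  rw [neg_neg] at hm hl
  refine ⟨hs, ht, fun x => v (u x + k), ⟨?_, {s | s ∈ I ∧ u s + k ∈ u '' I},
    {s | s ∈ I ∧ u s + (-k : ℤ) ∈ u '' I}, fun x => v (u x + k), fun x => v (u x + (-k : ℤ)),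
    hu.isOpenInterval_dom hI (hD hs) (hdom s hs).2,
    hu.isOpenInterval_dom hI (hP ht) ⟨s, hD hs, by rw [hst]; push_cast; ring⟩, hdom,
    fun _ _ => rfl, hmaps k, hm, ⟨hleft k, hl⟩, hana k, hana (-k)⟩, hvt s hs t ht hst, ?_⟩
  · ext y
    constructor
    · rintro ⟨x, hx, rfl⟩
      obtain ⟨t, ht, hst⟩ := h1 x hx
      rw [show (fun x => v (u x + k)) x = t from hvt x hx t ht hst]
      exact ht
    · intro hy
      obtain ⟨x, hx, hxy⟩ := h2 y hy
      exact ⟨x, hx, hvt x hx y hy hxy⟩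
  · intro x hx
    obtain ⟨t, ht, hst⟩ := h1 x hx
    simp only [hvt x hx t ht hst]
    exact (hu.smul_eq x (hD hx) t (hP ht) k hst).symm

variable [T2Space M]

/-- Each interval of length `1` in the coordinate is free: an overlap can be carried to `[α, β]`
piecewise, and there it has to be trivial. -/
lemma isFreeSegment (hu : IsDevelopment γ I α β h u) (H : IsShift E γ I α β h) {b' b : ℝ}
    (hb' : b' ∈ I) (hb : b ∈ I) (hbb : u b = u b' + 1) : IsFreeSegment G E γ (Icc b' b) := by
  have hI := H.isOpenInterval
  have hsub : Icc b' b ⊆ I := hI.1.1.out hb' hb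
  refine ⟨⟨I, γ, hI, hsub, fun _ _ => rfl, fun t ht => (H.immersiveAt t ht).1.contMDiffWithinAt,
    fun t ht => (H.immersiveAt t ht).2⟩, fun k hk => ?_⟩
  obtain ⟨J, τ, hJne, hJo, hJ, hτJ, hτi, hg⟩ := hk.exists_germLift H.contMDiff_smul H.immersiveAt
    hsub
  have hJ' : J ⊆ Ioo b' b := by
    rw [← interior_Icc]; exact interior_maximal hJ hJo
  have hui : InjOn u J := hu.strictMonoOn.injOn.mono (hJ.trans hsub)
  have huτi : InjOn (u ∘ τ) J := hu.strictMonoOn.injOn.comp hτi fun x hx => hsub (hτJ hx)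
  have hc1 : (J ∩ u ⁻¹' range ((↑) : ℤ → ℝ)).Countable := by
    refine (MapsTo.countable_of_injOn (f := u) (t := range ((↑) : ℤ → ℝ)) (fun x hx => hx.2)
      (hui.mono inter_subset_left) (countable_range _))
  have hc2 : (J ∩ (u ∘ τ) ⁻¹' range ((↑) : ℤ → ℝ)).Countable := by
    refine (MapsTo.countable_of_injOn (f := u ∘ τ) (t := range ((↑) : ℤ → ℝ)) (fun x hx => hx.2)
      (huτi.mono inter_subset_left) (countable_range _))
  -- A generic point of the overlap avoids the end points of all pieces.
  obtain ⟨t, htJ, ht1, ht2⟩ : ∃ t ∈ J, (∀ n : ℤ, u t ≠ n) ∧ ∀ n : ℤ, u (τ t) ≠ n := by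
    by_contra! hcon
    have : J ⊆ (J ∩ u ⁻¹' range ((↑) : ℤ → ℝ)) ∪ (J ∩ (u ∘ τ) ⁻¹' range ((↑) : ℤ → ℝ)) := by
      intro t ht
      by_cases h1 : ∀ n : ℤ, u t ≠ n
      · obtain ⟨n, hn⟩ := hcon t ht h1
        exact Or.inr ⟨ht, n, hn.symm⟩
      · push Not at h1
        obtain ⟨n, hn⟩ := h1
        exact Or.inl ⟨ht, n, hn.symm⟩
    have hJc := (hc1.union hc2).mono this
    obtain ⟨x, hx, hx'⟩ := (hJc.dense_compl ℝ).inter_open_nonempty J hJo hJne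
    exact hx' hx
  obtain ⟨ε, hε⟩ := hg t htJ
  have htI := hsub (hJ htJ)
  have hsI := hsub (hτJ htJ)
  obtain ⟨t₀, ht₀, hut⟩ := hu.exists_mem_Ioo H ht1
  obtain ⟨s₀, hs₀, hus⟩ := hu.exists_mem_Ioo H ht2
  have g1 := hu.germLift H (H.subset (Ioo_subset_Icc_self ht₀)) htI hut
  have g2 := (hu.germLift H (H.subset (Ioo_subset_Icc_self hs₀)) hsI hus).symm
  have g3 := (g1.comp hε).comp g2
  have hmem := H.mem_stabilizer ht₀ hs₀ g3
  have heq := H.eq_of_germLift hmem (Ioo_subset_Icc_self ht₀) (Ioo_subset_Icc_self hs₀) g3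
  subst heq
  have hut1 : u b' < u t := hu.strictMonoOn hb' htI (hJ' htJ).1
  have hut2 : u t < u b := hu.strictMonoOn htI hb (hJ' htJ).2
  have hus1 : u b' ≤ u (τ t) := (hu.strictMonoOn.le_iff_le hb' hsI).2 (hτJ htJ).1
  have hus2 : u (τ t) ≤ u b := (hu.strictMonoOn.le_iff_le hsI hb).2 (hτJ htJ).2
  have hfl : ⌊u t⌋ = ⌊u (τ t)⌋ := by
    have h1 : (⌊u t⌋ : ℝ) < ⌊u (τ t)⌋ + 1 := by linarith
    have h2 : (⌊u (τ t)⌋ : ℝ) < ⌊u t⌋ + 1 := by linarith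
    have h1' : ⌊u t⌋ < ⌊u (τ t)⌋ + 1 := by exact_mod_cast h1
    have h2' : ⌊u (τ t)⌋ < ⌊u t⌋ + 1 := by exact_mod_cast h2
    omega
  rw [← hfl] at hmem
  have hk' : k ∈ curveStabilizer G γ I := by
    have h1 := (Subgroup.mem_normalizer_iff.1 (zpow_mem H.mem_normalizer ⌊u t⌋) _).1 hmem
    rwa [show h ^ ⌊u t⌋ * ((h ^ ⌊u t⌋)⁻¹ * (k * h ^ ⌊u t⌋)) * (h ^ ⌊u t⌋)⁻¹ = k by group] at h1
  exact fun x hx => mem_curveStabilizer.1 hk' x (hsub hx)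

/-- Each interval of length `1` in the coordinate is a maximal free interval. -/
lemma isMaximalInterval (hu : IsDevelopment γ I α β h u) (H : IsShift E γ I α β h) {b' b : ℝ}
    (hb' : b' ∈ I) (hb : b ∈ I) (hbb : u b = u b' + 1) : IsMaximalInterval G E γ I (Icc b' b) := by
  have hI := H.isOpenInterval
  have hsub : Icc b' b ⊆ I := hI.1.1.out hb' hb
  have hlt : b' < b := by
    rw [← hu.strictMonoOn.lt_iff_lt hb' hb]; linarith
  refine ⟨⟨ordConnected_Icc, by rw [interior_Icc]; exact nonempty_Ioo.2 hlt⟩, hsub,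
    hu.isFreeSegment H hb' hb hbb, fun A' hA' hA'I hfree hle => ?_⟩
  refine Subset.antisymm (fun y hy => ?_) hle
  have hyI := hA'I hy
  have hb'A := hle (left_mem_Icc.2 hlt.le)
  have hbA := hle (right_mem_Icc.2 hlt.le)
  -- On a larger free interval, a germ of the shift would have both points inside.
  have key : ∀ x z : ℝ, x ∈ A' → z ∈ A' → u x + 1 < u z → False := by
    intro x z hx hz hxz
    have hxI := hA'I hx
    have hzI := hA'I hz
    obtain ⟨p, hp1, hp2⟩ := exists_between (show u x < u z - 1 by linarith)
    have hconn := hu.ordConnected_image hI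
    obtain ⟨t, ht, htp⟩ := hconn.out (mem_image_of_mem u hxI) (mem_image_of_mem u hzI)
      (⟨hp1.le, by linarith⟩ : p ∈ Icc (u x) (u z))
    obtain ⟨s, hs, hsp⟩ := hconn.out (mem_image_of_mem u hxI) (mem_image_of_mem u hzI)
      (⟨by linarith, by linarith⟩ : p + 1 ∈ Icc (u x) (u z))
    have hint : Ioo x z ⊆ interior A' :=
      interior_maximal (Ioo_subset_Icc_self.trans (hA'.1.out hx hz)) isOpen_Ioo
    have g1 := hu.germLift H (k := 1) ht hs (by rw [hsp, htp]; simp)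
    rw [zpow_one] at g1
    refine H.not_mem (hfree.mem_stabilizer H.contMDiff_smul hI H.immersiveAt hA'I
      (hint ⟨?_, ?_⟩) (hint ⟨?_, ?_⟩) g1)
    · rw [← hu.strictMonoOn.lt_iff_lt hxI ht]; linarith
    · rw [← hu.strictMonoOn.lt_iff_lt ht hzI]; linarith
    · rw [← hu.strictMonoOn.lt_iff_lt hxI hs]; linarith
    · rw [← hu.strictMonoOn.lt_iff_lt hs hzI]; linarith
  constructor
  · by_contra hc
    exact key y b hy hbA (by linarith [hu.strictMonoOn hyI hb' (not_le.1 hc)])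
  · by_contra hc
    exact key b' y hb'A hy (by linarith [hu.strictMonoOn hb hyI (not_le.1 hc)])

end IsDevelopment

end Translations

/-! ### Positivity of unit intervals -/

section UnitIntervals

/-- The number of unit steps to the right that stay in `S`, as an upper bound for the indices of a
decomposition. -/
lemma exists_withTop_le_iff {S : Set ℝ} (hS : S.OrdConnected) {x : ℝ} (h1 : x + 1 ∈ S) :
    ∃ hi : WithTop ℤ, 0 < hi ∧ ∀ n : ℤ, 1 ≤ n → ((n : WithTop ℤ) ≤ hi ↔ x + n ∈ S) := by
  by_cases hall : ∀ n : ℤ, 1 ≤ n → x + n ∈ S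
  · exact ⟨⊤, WithTop.coe_lt_top 0, fun n hn => ⟨fun _ => hall n hn, fun _ => le_top⟩⟩
  push Not at hall
  obtain ⟨N, hN1, hN⟩ := hall
  obtain ⟨m, ⟨hm1, hm⟩, hmax⟩ := Int.exists_greatest_of_bdd (P := fun n : ℤ => 1 ≤ n ∧ x + n ∈ S)
    ⟨N, fun n hn => by
      by_contra hc
      have : (N : ℝ) ≤ n := by exact_mod_cast (not_le.1 hc).le
      have hN1' : (1 : ℝ) ≤ N := by exact_mod_cast hN1
      exact hN (hS.out h1 hn.2 ⟨by linarith, by linarith⟩)⟩ ⟨1, le_rfl, by simpa using h1⟩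
  refine ⟨(m : ℤ), WithTop.coe_lt_coe.2 (by omega), fun n hn => ?_⟩
  rw [WithTop.coe_le_coe]
  refine ⟨fun h => ?_, fun h => hmax n ⟨hn, h⟩⟩
  have hn' : (1 : ℝ) ≤ n := by exact_mod_cast hn
  have h' : (n : ℝ) ≤ m := by exact_mod_cast h
  exact hS.out h1 hm ⟨by linarith, by linarith⟩

/-- The counterpart of `exists_withTop_le_iff` to the left. The strict inequality accounts for the
index `0` being skipped. -/
lemma exists_withBot_lt_iff {S : Set ℝ} (hS : S.OrdConnected) {x : ℝ} (h0 : x ∈ S) :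
    ∃ lo : WithBot ℤ, lo < 0 ∧ ∀ n : ℤ, n ≤ 0 → (lo < (n : WithBot ℤ) ↔ x + n ∈ S) := by
  by_cases hall : ∀ n : ℤ, n ≤ 0 → x + n ∈ S
  · exact ⟨⊥, WithBot.bot_lt_coe 0, fun n hn => ⟨fun _ => hall n hn, fun _ => WithBot.bot_lt_coe n⟩⟩
  push Not at hall
  obtain ⟨N, hN1, hN⟩ := hall
  obtain ⟨m, ⟨hm1, hm⟩, hmin⟩ := Int.exists_least_of_bdd (P := fun n : ℤ => n ≤ 0 ∧ x + n ∈ S)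
    ⟨N, fun n hn => by
      by_contra hc
      have : (n : ℝ) ≤ N := by exact_mod_cast (not_le.1 hc).le
      have hN1' : (N : ℝ) ≤ 0 := by exact_mod_cast hN1
      exact hN (hS.out hn.2 h0 ⟨by linarith, by linarith⟩)⟩ ⟨0, le_rfl, by simpa using h0⟩
  refine ⟨((m - 1 : ℤ) : WithBot ℤ), WithBot.coe_lt_coe.2 (by omega), fun n hn => ?_⟩
  rw [WithBot.coe_lt_coe]
  refine ⟨fun h => ?_, fun h => by have := hmin n ⟨hn, h⟩; omega⟩
  have hn' : (n : ℝ) ≤ 0 := by exact_mod_cast hn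
  have h' : (m : ℝ) ≤ n := by exact_mod_cast (by omega : m ≤ n)
  exact hS.out hm h0 ⟨by linarith, by linarith⟩

variable {G : Type*} [Group G]
  {E : Type*} [NormedAddCommGroup E] [NormedSpace ℝ E]
  {M : Type*} [TopologicalSpace M] [ChartedSpace E M] [MulAction G M]
  {γ : ℝ → M} {I : Set ℝ} {α β : ℝ} {h : G} {u : ℝ → ℝ}

lemma IsShift.congr (H : IsShift E γ I α β h) {k : G} (hk : h⁻¹ * k ∈ curveStabilizer G γ I) :
    IsShift E γ I α β k := by
  refine ⟨H.contMDiff_smul, H.isOpenInterval, H.immersiveAt, H.lt, H.subset, H.free, ?_, ?_⟩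
  · obtain ⟨τ, h1, h2, h3, h4⟩ := H.germ
    refine ⟨τ, h1, h2, h3, ?_⟩
    filter_upwards [h4, H.isOpenInterval.2.mem_nhds H.left_mem] with x hx hxI
    rw [hx, smul_eq_smul_of_mem_stabilizer hk hxI]
  · intro hc
    refine H.not_mem ?_
    have := mul_mem hc (inv_mem hk)
    rwa [show k * (h⁻¹ * k)⁻¹ = h by group] at this

lemma IsDevelopment.mem_interior_piece_iff {d : IntervalDecomp I}
    (hu : IsDevelopment γ I α β h u) (H : IsShift E γ I α β h)
    (hpiece : ∀ n : ℤ, d.lo ≤ (n : WithBot ℤ) → (n : WithTop ℤ) ≤ d.hi →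
      ∀ t ∈ d.piece n, (n : ℝ) ≤ u t ∧ u t ≤ n + 1)
    (hknot : ∀ n : ℤ, d.lo < (n : WithBot ℤ) → (n : WithTop ℤ) ≤ d.hi → u (d.knot n) = n)
    {n : ℤ} (h1 : d.lo ≤ (n : WithBot ℤ)) (h2 : (n : WithTop ℤ) ≤ d.hi) {t : ℝ} :
    t ∈ interior (d.piece n) ↔ t ∈ I ∧ (n : ℝ) < u t ∧ u t < n + 1 := by
  have hI := H.isOpenInterval
  have hsm := hu.strictMonoOn
  constructor
  · intro ht
    have htI := d.piece_subset hI h1 (interior_subset ht)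
    have hN := mem_interior_iff_mem_nhds.1 ht
    refine ⟨htI, ?_, ?_⟩
    · obtain ⟨s, hs, hst⟩ := ((show ∀ᶠ s in 𝓝[<] t, s ∈ d.piece n from
        nhdsWithin_le_nhds hN).and self_mem_nhdsWithin).exists
      exact (hpiece n h1 h2 s hs).1.trans_lt (hsm (d.piece_subset hI h1 hs) htI hst)
    · obtain ⟨s, hs, hst⟩ := ((show ∀ᶠ s in 𝓝[>] t, s ∈ d.piece n from
        nhdsWithin_le_nhds hN).and self_mem_nhdsWithin).exists
      exact (hsm htI (d.piece_subset hI h1 hs) hst).trans_le (hpiece n h1 h2 s hs).2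
  · rintro ⟨htI, ht1, ht2⟩
    rw [d.mem_interior_piece_iff hI h1]
    refine ⟨htI, fun hl => ?_, fun hh => ?_⟩
    · rw [← hsm.lt_iff_lt (d.knot_mem hl h2) htI, hknot n hl h2]; exact ht1
    · have hl := d.lo_lt_of_lt h1 (by omega : n < n + 1)
      have hh' := d.lt_hi_iff.1 hh
      rw [← hsm.lt_iff_lt htI (d.knot_mem hl hh'), hknot _ hl hh']
      push_cast; exact ht2

variable [FiniteDimensional ℝ E] [T2Space M]

namespace IsDevelopment

/-- Each interval of length `1` in the coordinate is positive: its translates by the powers of the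
shift decompose the curve. -/
lemma isPositiveInterval (hu : IsDevelopment γ I α β h u) (H : IsShift E γ I α β h) {b' b : ℝ}
    (hb' : b' ∈ I) (hb : b ∈ I) (hbb : u b = u b' + 1) : IsPositiveInterval G E γ I b' b := by
  have hI := H.isOpenInterval
  have hT := hu.ordConnected_image hI
  have hsm := hu.strictMonoOn
  have hlt : b' < b := by
    rw [← hsm.lt_iff_lt hb' hb]; linarith
  obtain ⟨v, hv⟩ := exists_inv u I
  set x := u b' with hx
  have hx0 : x ∈ u '' I := mem_image_of_mem u hb'
  have hx1 : x + 1 ∈ u '' I := ⟨b, hb, hbb⟩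
  obtain ⟨hi, hi0, hhi⟩ := exists_withTop_le_iff hT hx1
  obtain ⟨lo, lo0, hlo⟩ := exists_withBot_lt_iff hT hx0
  have hlo' : ∀ n : ℤ, lo ≤ (n : WithBot ℤ) ↔ lo < ((n + 1 : ℤ) : WithBot ℤ) := by
    intro n
    cases lo with
    | bot => simp
    | coe m => simp only [WithBot.coe_lt_coe, WithBot.coe_le_coe]; omega
  have hmem : ∀ n ∈ decompIndex lo hi, x + (if 1 ≤ n then n else n + 1 : ℤ) ∈ u '' I := by
    rintro n ⟨h0, h1, h2⟩
    split_ifs with hn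
    · exact (hhi n hn).1 h2
    · exact (hlo (n + 1) (by omega)).1 ((hlo' n).1 h1)
  let d : IntervalDecomp I :=
    { lo := lo
      hi := hi
      lo_neg := lo0
      hi_pos := hi0
      a := fun n => v (x + (if 1 ≤ n then n else n + 1 : ℤ))
      mem_interior := fun n hn => by
        rw [hI.2.interior_eq]; exact (hv _ (hmem n hn)).1
      strictMono := fun m hm n hn hmn => by
        rw [← hsm.lt_iff_lt (hv _ (hmem m hm)).1 (hv _ (hmem n hn)).1, (hv _ (hmem m hm)).2,
          (hv _ (hmem n hn)).2, add_lt_add_iff_left, Int.cast_lt]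
        have h1 := hm.1
        have h2 := hn.1
        split_ifs <;> omega }
  have hknot : ∀ n : ℤ, d.knot n = v (x + n) := by
    intro n
    show (if 1 ≤ n then v (x + (if 1 ≤ n then n else n + 1 : ℤ))
      else v (x + (if 1 ≤ n - 1 then n - 1 else n - 1 + 1 : ℤ))) = v (x + n)
    split_ifs with h1 h2
    · rfl
    · omega
    · rw [sub_add_cancel]
  have huk : ∀ n : ℤ, d.lo < (n : WithBot ℤ) → (n : WithTop ℤ) ≤ d.hi →
      u (d.knot n) = x + n := by
    intro n h1 h2
    rw [hknot]
    refine (hv _ ?_).2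
    by_cases hn : 1 ≤ n
    · exact (hhi n hn).1 h2
    · exact (hlo n (by omega)).1 h1
  have hvx : v x = b' := hsm.injOn (hv x hx0).1 hb' (hv x hx0).2
  have hvx1 : v (x + 1) = b := hsm.injOn (hv _ hx1).1 hb ((hv _ hx1).2.trans hbb.symm)
  have hiv : ∀ p ∈ I, ∀ q ∈ I, p ≤ q → ∀ y ∈ Icc (u p) (u q), ∃ t ∈ Icc p q, u t = y := by
    intro p hp q hq hpq y hy
    exact intermediate_value_Icc hpq (hu.continuousOn.mono (hI.1.1.out hp hq)) hy
  have hsub : Icc b' b ⊆ I := hI.1.1.out hb' hb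
  have hucc : ∀ s ∈ Icc b' b, x ≤ u s ∧ u s ≤ x + 1 := fun s hs => by
    rw [← hbb]
    exact ⟨(hsm.le_iff_le hb' (hsub hs)).2 hs.1, (hsm.le_iff_le (hsub hs) hb).2 hs.2⟩
  have hrel : ∀ n : ℤ, d.lo ≤ (n : WithBot ℤ) → (n : WithTop ℤ) ≤ d.hi →
      PosRel (fun t => h ^ n • γ t) b' b γ (d.piece n) := by
    intro n h1 h2
    have hPI := d.piece_subset hI h1
    by_cases hl : d.lo < (n : WithBot ℤ)
    · have hleast := d.isLeast_piece hI hl h2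
      have hkn := huk n hl h2
      have hknI := d.knot_mem hl h2
      by_cases hh : (n : WithTop ℤ) < d.hi
      · have hl1 := d.lo_lt_of_lt h1 (by omega : n < n + 1)
        have hh1 := d.lt_hi_iff.1 hh
        have hkn1 := huk (n + 1) hl1 hh1
        have hkn1I := d.knot_mem hl1 hh1
        have hkk := d.knot_lt hl hh1 (by omega : n < n + 1)
        push_cast at hkn1
        refine Or.inl ⟨d.knot n, hleast, hu.relAt H hsub hPI ?_ ?_ (left_mem_Icc.2 hlt.le)
          hleast.1 hkn⟩
        · rw [d.piece_of_lt hl hh]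
          intro s hs
          have := hucc s hs
          exact hiv _ hknI _ hkn1I hkk.le _ ⟨by linarith, by linarith⟩
        · rw [d.piece_of_lt hl hh]
          intro t ht
          have htI := hI.1.1.out hknI hkn1I ht
          have e1 := (hsm.le_iff_le hknI htI).2 ht.1
          have e2 := (hsm.le_iff_le htI hkn1I).2 ht.2
          obtain ⟨s, hs, hst⟩ := hiv b' hb' b hb hlt.le (u t - n) ⟨by linarith, by linarith⟩
          exact ⟨s, hs, by linarith⟩
      · -- The last piece corresponds to the points whose translates have not left `I` yet.
        have hn0 : 0 < n := by
          by_contra hn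
          exact hh ((WithTop.coe_le_coe.2 (not_lt.1 hn)).trans_lt d.zero_lt_hi)
        have hnot : x + n + 1 ∉ u '' I := fun hc => hh (d.lt_hi_iff.2 ((hhi (n + 1)
          (by omega)).2 (by push_cast; rwa [← add_assoc])))
        have hkT : x + n ∈ u '' I := ⟨_, hknI, hkn⟩
        have hbd : ∀ y ∈ u '' I, y < x + n + 1 := fun y hy => by
          by_contra hc
          exact hnot (hT.out hkT hy ⟨by linarith, not_lt.1 hc⟩)
        have hbdd : BddAbove (u '' I) := ⟨_, fun y hy => (hbd y hy).le⟩
        have hsup : ∀ y ∈ u '' I, y < sSup (u '' I) := fun y hy => by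
          obtain ⟨z, hyz, hz⟩ := ((hu.isOpen_image hI).mem_nhds hy |>
            (nhdsWithin_le_nhds (s := Ioi y) ·) |> inter_mem self_mem_nhdsWithin |>
              Filter.nonempty_of_mem)
          exact hyz.trans_le (le_csSup hbdd hz)
        have hq1 : sSup (u '' I) ≤ x + n + 1 := csSup_le ⟨_, hkT⟩ fun y hy => (hbd y hy).le
        have hq2 := hsup _ hkT
        obtain ⟨j, hj, huj⟩ := hiv b' hb' b hb hlt.le (sSup (u '' I) - n)
          ⟨by linarith, by linarith⟩
        have hjI := hsub hj
        have hbj : b' < j := by rw [← hsm.lt_iff_lt hb' hjI]; linarith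
        have hIco : Ico b' j ⊆ Icc b' b := fun s hs => ⟨hs.1, hs.2.le.trans hj.2⟩
        refine Or.inr (Or.inl ⟨d.knot n, hleast, j, hbj, hj.2, hu.relAt H (hIco.trans hsub) hPI
          ?_ ?_ (left_mem_Ico.2 hbj) hleast.1 hkn⟩)
        · intro s hs
          have e1 := hucc s (hIco hs)
          have e2 := hsm (hsub (hIco hs)) hjI hs.2
          obtain ⟨y, hy, hy'⟩ := exists_lt_of_lt_csSup ⟨_, hkT⟩
            (show u s + n < sSup (u '' I) by linarith)
          obtain ⟨t, ht, hut⟩ := hT.out hkT hy (⟨by linarith, hy'.le⟩ : u s + n ∈ Icc _ _)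
          refine ⟨t, ?_, hut⟩
          rw [d.piece_of_not_hi hn0 hh]
          exact ⟨ht, (hsm.le_iff_le hknI ht).1 (by linarith)⟩
        · intro t ht
          rw [d.piece_of_not_hi hn0 hh] at ht
          have e1 := (hsm.le_iff_le hknI ht.1).2 ht.2
          have e2 := hsup _ (mem_image_of_mem u ht.1)
          obtain ⟨s, hs, hst⟩ := hiv b' hb' b hb hlt.le (u t - n) ⟨by linarith, by linarith⟩
          refine ⟨s, ⟨hs.1, ?_⟩, by linarith⟩
          rw [← hsm.lt_iff_lt (hsub hs) hjI]; linarith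
    · have hn0 : n < 0 := by
        by_contra hn
        exact hl (d.lo_lt_zero.trans_le (WithBot.coe_le_coe.2 (not_lt.1 hn)))
      have hh : (n : WithTop ℤ) < d.hi := (WithTop.coe_lt_coe.2 hn0).trans d.zero_lt_hi
      have hl1 := d.lo_lt_of_lt h1 (by omega : n < n + 1)
      have hh1 := d.lt_hi_iff.1 hh
      have hgr := d.isGreatest_piece hI h1 hh
      have hkn := huk (n + 1) hl1 hh1
      have hknI := d.knot_mem hl1 hh1
      push_cast at hkn
      have hnot : x + n ∉ u '' I := fun hc => hl ((hlo n hn0.le).2 hc)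
      have hkT : x + n + 1 ∈ u '' I := ⟨_, hknI, by linarith⟩
      have hbd : ∀ y ∈ u '' I, x + n < y := fun y hy => by
        by_contra hc
        exact hnot (hT.out hy hkT ⟨not_lt.1 hc, by linarith⟩)
      have hbdd : BddBelow (u '' I) := ⟨_, fun y hy => (hbd y hy).le⟩
      have hinf : ∀ y ∈ u '' I, sInf (u '' I) < y := fun y hy => by
        obtain ⟨z, hyz, hz⟩ := ((hu.isOpen_image hI).mem_nhds hy |>
          (nhdsWithin_le_nhds (s := Iio y) ·) |> inter_mem self_mem_nhdsWithin |>
            Filter.nonempty_of_mem)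
        exact (csInf_le hbdd hz).trans_lt hyz
      have hq1 : x + n ≤ sInf (u '' I) := le_csInf ⟨_, hkT⟩ fun y hy => (hbd y hy).le
      have hq2 := hinf _ hkT
      obtain ⟨j, hj, huj⟩ := hiv b' hb' b hb hlt.le (sInf (u '' I) - n)
        ⟨by linarith, by linarith⟩
      have hjI := hsub hj
      have hbj : j < b := by rw [← hsm.lt_iff_lt hjI hb]; linarith
      have hIoc : Ioc j b ⊆ Icc b' b := fun s hs => ⟨hj.1.trans hs.1.le, hs.2⟩
      refine Or.inr (Or.inr ⟨d.knot (n + 1), hgr, j, hj.1, hbj, hu.relAt H (hIoc.trans hsub) hPI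
        ?_ ?_ (right_mem_Ioc.2 hbj) hgr.1 (by linarith)⟩)
      · intro s hs
        have e1 := hucc s (hIoc hs)
        have e2 := hsm hjI (hsub (hIoc hs)) hs.1
        obtain ⟨y, hy, hy'⟩ := exists_lt_of_csInf_lt ⟨_, hkT⟩
          (show sInf (u '' I) < u s + n by linarith)
        obtain ⟨t, ht, hut⟩ := hT.out hy hkT (⟨hy'.le, by linarith⟩ : u s + n ∈ Icc _ _)
        refine ⟨t, ?_, hut⟩
        rw [d.piece_of_not_lo hn0 hl]
        exact ⟨ht, (hsm.le_iff_le ht hknI).1 (by linarith)⟩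
      · intro t ht
        rw [d.piece_of_not_lo hn0 hl] at ht
        have e1 := (hsm.le_iff_le ht.1 hknI).2 ht.2
        have e2 := hinf _ (mem_image_of_mem u ht.1)
        obtain ⟨s, hs, hst⟩ := hiv b' hb' b hb hlt.le (u t - n) ⟨by linarith, by linarith⟩
        refine ⟨s, ⟨?_, hs.2⟩, by linarith⟩
        rw [← hsm.lt_iff_lt hjI (hsub hs)]; linarith
  have h1i : ((1 : ℤ) : WithTop ℤ) ≤ d.hi := d.lt_hi_iff.1 d.zero_lt_hi
  have h1l : d.lo ≤ ((1 : ℤ) : WithBot ℤ) := d.lo_lt_zero.le.trans (WithBot.coe_le_coe.2 (by omega))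
  have h2l : d.lo ≤ ((-1 : ℤ) : WithBot ℤ) := d.lo_lt_iff.1 d.lo_lt_zero
  have h2i : ((-1 : ℤ) : WithTop ℤ) ≤ d.hi :=
    ((WithTop.coe_le_coe.2 (by omega)).trans_lt d.zero_lt_hi).le
  refine ⟨d, fun n => h ^ n, ⟨hu.isFreeSegment H hb' hb hbb, ?_, ?_, ?_, ?_, ?_⟩, hrel 1 h1l h1i,
    hrel (-1) h2l h2i⟩
  · have := hknot 0
    rw [Int.cast_zero, add_zero, hvx] at this
    exact this
  · have := hknot 1
    rw [Int.cast_one, hvx1] at this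
    exact this
  · exact curveClass_ne_one_iff.2 (by simpa using H.not_mem)
  · exact curveClass_ne_one_iff.2 (by simpa using H.not_mem)
  · exact fun n hn => Or.inl (hrel n hn.2.1 hn.2.2)

/-- Compact maximal free intervals have length `1` in the coordinate. -/
lemma eq_add_one_of_isMaximalInterval (hu : IsDevelopment γ I α β h u) (H : IsShift E γ I α β h)
    {b' b : ℝ} (hb' : b' ∈ I) (hb : b ∈ I) (hlt : b' < b)
    (hmax : IsMaximalInterval G E γ I (Icc b' b)) : u b = u b' + 1 := by
  have hT := hu.ordConnected_image H.isOpenInterval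
  have hsm := hu.strictMonoOn
  have h0T : (0 : ℝ) ∈ u '' I := ⟨α, H.left_mem, hu.left⟩
  have h1T : (1 : ℝ) ∈ u '' I := ⟨β, H.right_mem, hu.right⟩
  have hb'T := mem_image_of_mem u hb'
  have hbT := mem_image_of_mem u hb
  have hbb := hsm hb' hb hlt
  have hinj : ∀ p q r s : ℝ, r ≤ s → Icc p q = Icc r s → p = r ∧ q = s := by
    intro p q r s hrs heq
    exact (Icc_eq_Icc_iff (by rw [← nonempty_Icc, heq]; exact nonempty_Icc.2 hrs)).1 heq
  rcases lt_trichotomy (u b) (u b' + 1) with hlt1 | heq | hgt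
  · -- A shorter interval is properly contained in one of length `1`.
    obtain ⟨z, hz, hz1, hz2, hz3⟩ : ∃ z ∈ u '' I, z + 1 ∈ u '' I ∧ z ≤ u b' ∧ u b ≤ z + 1 := by
      by_cases h1 : 1 < u b
      · exact ⟨u b - 1, hT.out h0T hb'T ⟨by linarith, by linarith⟩, by rwa [sub_add_cancel],
          by linarith, by linarith⟩
      · by_cases h2 : 0 ≤ u b'
        · exact ⟨0, h0T, by rwa [zero_add], h2, by linarith⟩
        · exact ⟨u b', hb'T, hT.out hbT h1T ⟨hlt1.le, by linarith⟩, le_rfl, hlt1.le⟩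
    obtain ⟨p, hp, rfl⟩ := hz
    obtain ⟨q, hq, hqp⟩ := hz1
    have hpb : p ≤ b' := (hsm.le_iff_le hp hb').1 hz2
    have hbq : b ≤ q := (hsm.le_iff_le hb hq).1 (by linarith)
    have hm := hu.isMaximalInterval H hp hq hqp
    have := hmax.2.2.2 _ hm.1 hm.2.1 hm.2.2.1 (Icc_subset_Icc hpb hbq)
    obtain ⟨rfl, rfl⟩ := hinj _ _ _ _ hlt.le this
    exact hqp
  · exact heq
  · obtain ⟨q, hq, hqp⟩ := hT.out hb'T hbT (⟨by linarith, hgt.le⟩ : u b' + 1 ∈ Icc _ _)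
    have hqb : q ≤ b := (hsm.le_iff_le hq hb).1 (by linarith)
    have hm := hu.isMaximalInterval H hb' hq hqp
    have := hm.2.2.2 _ hmax.1 hmax.2.1 hmax.2.2.1 (Icc_subset_Icc le_rfl hqb)
    have hb'q : b' ≤ q := (hsm.le_iff_le hb' hq).1 (by linarith)
    obtain ⟨-, rfl⟩ := hinj _ _ _ _ hb'q this
    exact hqp

end IsDevelopment

/-- A shift of one positive interval is a shift of every other one: both are intervals of length `1`
in the same coordinate. -/
lemma IsPositiveInterval.isShift (hsated : IsSatedAction G M) (H : IsShift E γ I α β h)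
    (hpos : IsPositiveInterval G E γ I α β) {α' β' : ℝ}
    (hpos' : IsPositiveInterval G E γ I α' β') : IsShift E γ I α' β' h := by
  obtain ⟨h', H'⟩ := hpos'.exists_isShift H.contMDiff_smul H.isOpenInterval H.immersiveAt
  obtain ⟨d, g, hd, -⟩ := hpos
  obtain ⟨d', g', hd', -⟩ := hpos'
  obtain ⟨u, hu, -⟩ := hd.exists_isDevelopment hsated H
  obtain ⟨u', hu', -⟩ := hd'.exists_isDevelopment hsated H'
  have hmax := hu'.isMaximalInterval H' H'.left_mem H'.right_mem (by rw [hu'.left, hu'.right]; simp)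
  have hlen := hu.eq_add_one_of_isMaximalInterval H H'.left_mem H'.right_mem H'.lt hmax
  have g1 := hu.germLift H (k := 1) H'.left_mem H'.right_mem (by rw [hlen]; simp)
  rw [zpow_one] at g1
  exact H'.congr (H'.mem_stabilizer_left (by simpa using g1.comp H'.germ.symm))

/-- Elements of the classes of powers of `h` multiply like these powers, because `h` normalizes the
stabilizer. -/
lemma IsShift.inv_mul_mem (H : IsShift E γ I α β h) {a b : G} {m n : ℤ}
    (ha : (h ^ m)⁻¹ * a ∈ curveStabilizer G γ I) (hb : (h ^ n)⁻¹ * b ∈ curveStabilizer G γ I) :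
    (a * b⁻¹)⁻¹ * h ^ (m - n) ∈ curveStabilizer G γ I := by
  have h1 := (Subgroup.mem_normalizer_iff.1 (zpow_mem H.mem_normalizer n) _).1
    (mul_mem hb (inv_mem ha))
  rw [zpow_sub]
  convert h1 using 1
  simp only [mul_inv_rev, inv_inv, mul_assoc, mul_inv_cancel_left]

lemma IsADecomp.inv_stepElement_mul_mem {d : IntervalDecomp I} {g : ℤ → G}
    (H : IsShift E γ I α β h) (hd : IsADecomp E γ I α β d g) {n : ℤ} (hn : n ∈ d.index) :
    (stepElement g n)⁻¹ * h ^ n.sign ∈ curveStabilizer G γ I := by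
  obtain ⟨h0, h1, h2⟩ := hn
  have key := (hd.posRel_zpow H h1 h2).1 h0
  unfold stepElement
  split_ifs with c1 c2
  · have h1' := d.lo_lt_of_lt h1 (by omega : n < n + 1)
    have h2' : ((n + 1 : ℤ) : WithTop ℤ) ≤ d.hi :=
      ((WithTop.coe_le_coe.2 (by omega)).trans_lt d.zero_lt_hi).le
    have := H.inv_mul_mem key ((hd.posRel_zpow H h1'.le h2').1 (by omega))
    rwa [show n - (n + 1) = n.sign by rw [Int.sign_eq_neg_one_of_neg (by omega)]; ring] at this
  · have h2' := (d.lt_hi_of_lt h2 (by omega : n - 1 < n)).le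
    have h1' : d.lo ≤ ((n - 1 : ℤ) : WithBot ℤ) :=
      d.lo_lt_zero.le.trans (WithBot.coe_le_coe.2 (by omega))
    have := H.inv_mul_mem key ((hd.posRel_zpow H h1' h2').1 (by omega))
    rwa [show n - (n - 1) = n.sign by rw [Int.sign_eq_one_of_pos (by omega)]; ring] at this
  · have : n.sign = n := by
      obtain rfl | rfl : n = 1 ∨ n = -1 := by omega
      · rfl
      · rfl
    rw [this, ← Subgroup.inv_mem_iff]
    simpa using key

end UnitIntervals

/-- Each parameter lies inside an interval of length `1` in the coordinate, because the range of
the coordinate is an open interval that contains `[0, 1]`. -/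
lemma IsDevelopment.exists_unit_interval {G : Type*} [Group G]
    {E : Type*} [NormedAddCommGroup E] [NormedSpace ℝ E]
    {M : Type*} [TopologicalSpace M] [ChartedSpace E M] [MulAction G M]
    {γ : ℝ → M} {I : Set ℝ} {α β : ℝ} {h : G} {u : ℝ → ℝ}
    (hu : IsDevelopment γ I α β h u) (H : IsShift E γ I α β h) {t : ℝ} (ht : t ∈ I) :
    ∃ b' ∈ I, ∃ b ∈ I, u b = u b' + 1 ∧ b' < t ∧ t < b := by
  have hI := H.isOpenInterval
  have hT := hu.ordConnected_image hI
  have hsm := hu.strictMonoOn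
  have h0T : (0 : ℝ) ∈ u '' I := ⟨α, H.left_mem, hu.left⟩
  have h1T : (1 : ℝ) ∈ u '' I := ⟨β, H.right_mem, hu.right⟩
  have htT := mem_image_of_mem u ht
  obtain ⟨y, hy, hy1, hy2, hy3⟩ : ∃ y ∈ u '' I, y + 1 ∈ u '' I ∧ y < u t ∧ u t < y + 1 := by
    rcases lt_or_ge (u t) 1 with h1 | h1
    · have hmT : min (u t) 0 ∈ u '' I := by
        rcases min_choice (u t) 0 with h | h <;> rw [h] <;> assumption
      have hev : ∀ᶠ y in 𝓝[<] (min (u t) 0), y ∈ u '' I ∧ u t - 1 < y :=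
        nhdsWithin_le_nhds (((hu.isOpen_image hI).eventually_mem hmT).and
          (lt_mem_nhds (lt_min (by linarith) (by linarith))))
      obtain ⟨y, ⟨hyT, hy1⟩, hy2⟩ := (hev.and self_mem_nhdsWithin).exists
      have hy3 : y < u t := lt_of_lt_of_le hy2 (min_le_left _ _)
      have hy4 : y < 0 := lt_of_lt_of_le hy2 (min_le_right _ _)
      exact ⟨y, hyT, hT.out htT h1T ⟨by linarith, by linarith⟩, hy3, by linarith⟩
    · have hev : ∀ᶠ y in 𝓝[>] (u t), y ∈ u '' I ∧ y < u t + 1 :=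
        nhdsWithin_le_nhds (((hu.isOpen_image hI).eventually_mem htT).and
          (gt_mem_nhds (by linarith)))
      obtain ⟨y, ⟨hyT, hy1⟩, hy2⟩ := (hev.and self_mem_nhdsWithin).exists
      have hy3 : u t < y := hy2
      exact ⟨y - 1, hT.out h0T htT ⟨by linarith, by linarith⟩, by rwa [sub_add_cancel],
        by linarith, by linarith⟩
  obtain ⟨b', hb', rfl⟩ := hy
  obtain ⟨b, hb, hbb⟩ := hy1
  exact ⟨b', hb', b, hb, hbb, (hsm.lt_iff_lt hb' ht).1 hy2, (hsm.lt_iff_lt ht hb).1 (by linarith)⟩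

theorem mainTheorem4
    {EG : Type*} [NormedAddCommGroup EG] [NormedSpace ℝ EG] [FiniteDimensional ℝ EG]
    {G : Type*} [TopologicalSpace G] [ChartedSpace EG G] [Group G] [LieGroup 𝓘(ℝ, EG) ω G]
    [T2Space G] [SecondCountableTopology G]
    {E : Type*} [NormedAddCommGroup E] [NormedSpace ℝ E] [FiniteDimensional ℝ E]
    {M : Type*} [TopologicalSpace M] [ChartedSpace E M] [IsManifold 𝓘(ℝ, E) ω M]
    [T2Space M] [SecondCountableTopology M]
    [MulAction G M]
    (hG : ∀ x : M, ContMDiff 𝓘(ℝ, EG) 𝓘(ℝ, E) ω (fun g : G => g • x))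
    (hM : ∀ g : G, ContMDiff 𝓘(ℝ, E) 𝓘(ℝ, E) ω (fun x : M => g • x))
    (hsated : IsSatedAction G M)
    (γ : ℝ → M) (I : Set ℝ) (hI : IsOpenInterval I)
    (himm : IsAnalyticImmersion E γ I)
    (hfree : IsFreeCurve G E γ I)
    (hpos : IsPositiveCurve G E γ I) :
    -- the class `[h] ≠ [e]`
    (∃ c : G ⧸ curveStabilizer G γ I, c ≠ curveClass γ I (1 : G) ∧
      (∀ h : G, curveClass γ I h = c →
        ∀ (α β : ℝ) (d : IntervalDecomp I) (g : ℤ → G),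
          IsPositiveInterval G E γ I α β → IsADecomp E γ I α β d g →
          ∀ n ∈ d.index,
            curveClass γ I (stepElement g n) = curveClass γ I (h ^ n.sign) ∧
            curveClass γ I (g n) = curveClass γ I (h ^ n) ∧
            PosRel (fun t => h ^ n • γ t) α β γ (d.piece n)) ∧
      -- each of the first two properties determines the class
      (∀ k : G,
        (∀ (α β : ℝ) (d : IntervalDecomp I) (g : ℤ → G),
          IsPositiveInterval G E γ I α β → IsADecomp E γ I α β d g →
          ∀ n ∈ d.index,
            curveClass γ I (stepElement g n) = curveClass γ I (k ^ n.sign)) →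
        curveClass γ I k = c) ∧
      (∀ k : G,
        (∀ (α β : ℝ) (d : IntervalDecomp I) (g : ℤ → G),
          IsPositiveInterval G E γ I α β → IsADecomp E γ I α β d g →
          ∀ n ∈ d.index,
            curveClass γ I (g n) = curveClass γ I (k ^ n)) →
        curveClass γ I k = c)) ∧
    -- positive intervals around each point
    (∀ t ∈ I, ∃ α β : ℝ, t ∈ interior (Icc α β) ∧
      IsMaximalInterval G E γ I (Icc α β) ∧ IsPositiveInterval G E γ I α β) ∧
    -- positive intervals with one prescribed endpoint
    (∀ (α β : ℝ) (d : IntervalDecomp I) (g : ℤ → G),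
      IsPositiveInterval G E γ I α β → IsADecomp E γ I α β d g →
      (∀ n : ℤ, d.lo < (n : WithBot ℤ) → n ≤ 0 → ∀ b' ∈ interior (d.piece (n - 1)),
        ∃ b ∈ interior (d.piece n),
          IsMaximalInterval G E γ I (Icc b' b) ∧ IsPositiveInterval G E γ I b' b) ∧
      (∀ n : ℤ, 0 ≤ n → (n : WithTop ℤ) < d.hi → ∀ b ∈ interior (d.piece (n + 1)),
        ∃ b' ∈ interior (d.piece n),
          IsMaximalInterval G E γ I (Icc b' b) ∧ IsPositiveInterval G E γ I b' b)) := by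
  have hγ := himm.immersiveAt hI.2
  obtain ⟨α₀, β₀, hpos₀⟩ := hpos
  obtain ⟨h, H₀⟩ := hpos₀.exists_isShift hM hI hγ
  have hH : ∀ α β, IsPositiveInterval G E γ I α β → ∀ k : G, curveClass γ I k = curveClass γ I h →
      IsShift E γ I α β k := fun α β hp k hk =>
    (hpos₀.isShift hsated H₀ hp).congr (curveClass_eq_iff.1 hk.symm)
  obtain ⟨d₀, g₀, hd₀, -⟩ := id hpos₀
  obtain ⟨u, hu, -⟩ := hd₀.exists_isDevelopment hsated H₀
  have hone : (1 : ℤ) ∈ d₀.index := ⟨one_ne_zero,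
    d₀.lo_lt_zero.le.trans (WithBot.coe_le_coe.2 (by omega)), d₀.lt_hi_iff.1 d₀.zero_lt_hi⟩
  have hg₀ : curveClass γ I (g₀ 1) = curveClass γ I h := by
    have := (hd₀.posRel_zpow H₀ hone.2.1 hone.2.2).1 one_ne_zero
    rw [zpow_one] at this
    exact (curveClass_eq_iff.2 this).symm
  refine ⟨⟨curveClass γ I h, curveClass_ne_one_iff.2 H₀.not_mem, ?_, ?_, ?_⟩, ?_, ?_⟩
  · intro k hk α β d g hp hd n hn
    have H := hH α β hp k hk
    have h1 := hd.posRel_zpow H hn.2.1 hn.2.2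
    exact ⟨curveClass_eq_iff.2 (hd.inv_stepElement_mul_mem H hn),
      (curveClass_eq_iff.2 (h1.1 hn.1)).symm, h1.2⟩
  · intro k hk
    have := hk α₀ β₀ d₀ g₀ hpos₀ hd₀ 1 hone
    rw [← hg₀]
    simpa [stepElement] using this.symm
  · intro k hk
    have := hk α₀ β₀ d₀ g₀ hpos₀ hd₀ 1 hone
    rw [← hg₀]
    simpa using this.symm
  · intro t ht
    obtain ⟨b', hb', b, hb, hbb, h1, h2⟩ := hu.exists_unit_interval H₀ ht
    exact ⟨b', b, by rw [interior_Icc]; exact ⟨h1, h2⟩, hu.isMaximalInterval H₀ hb' hb hbb,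
      hu.isPositiveInterval H₀ hb' hb hbb⟩
  · intro α β d g hp hd
    have H := hH α β hp h rfl
    obtain ⟨w, hw, hpiece, hknot⟩ := hd.exists_isDevelopment hsated H
    have hconn := hw.ordConnected_image hI
    constructor
    · intro n hlo hn b' hb'
      have hhi : (n : WithTop ℤ) < d.hi := (WithTop.coe_le_coe.2 hn).trans_lt d.zero_lt_hi
      have hlo1 := d.lo_lt_of_lt hlo.le (by omega : n < n + 1)
      rw [hw.mem_interior_piece_iff H hpiece hknot (d.lo_lt_iff.1 hlo)
        (d.lt_hi_of_lt hhi.le (by omega)).le] at hb'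
      obtain ⟨hb'I, h1, h2⟩ := hb'
      push_cast at h1 h2
      obtain ⟨b, hb, hbb⟩ := hconn.out (mem_image_of_mem w (d.knot_mem hlo hhi.le))
        (mem_image_of_mem w (d.knot_mem hlo1 (d.lt_hi_iff.1 hhi)))
        (show w b' + 1 ∈ Icc _ _ by
          rw [hknot n hlo hhi.le, hknot _ hlo1 (d.lt_hi_iff.1 hhi)]
          push_cast
          constructor <;> linarith)
      refine ⟨b, ?_, hw.isMaximalInterval H hb'I hb hbb, hw.isPositiveInterval H hb'I hb hbb⟩
      rw [hw.mem_interior_piece_iff H hpiece hknot hlo.le hhi.le]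
      exact ⟨hb, by linarith, by linarith⟩
    · intro n hn hhi b hb
      have hlo : d.lo < (n : WithBot ℤ) := d.lo_lt_zero.trans_le (WithBot.coe_le_coe.2 hn)
      have hlo1 := d.lo_lt_of_lt hlo.le (by omega : n < n + 1)
      rw [hw.mem_interior_piece_iff H hpiece hknot hlo1.le (d.lt_hi_iff.1 hhi)] at hb
      obtain ⟨hbI, h1, h2⟩ := hb
      push_cast at h1 h2
      obtain ⟨b', hb', hbb⟩ := hconn.out (mem_image_of_mem w (d.knot_mem hlo hhi.le))
        (mem_image_of_mem w (d.knot_mem hlo1 (d.lt_hi_iff.1 hhi)))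
        (show w b - 1 ∈ Icc _ _ by
          rw [hknot n hlo hhi.le, hknot _ hlo1 (d.lt_hi_iff.1 hhi)]
          push_cast
          constructor <;> linarith)
      have hbb' : w b = w b' + 1 := by linarith
      refine ⟨b', ?_, hw.isMaximalInterval H hb' hbI hbb', hw.isPositiveInterval H hb' hbI hbb'⟩
      rw [hw.mem_interior_piece_iff H hpiece hknot hlo.le hhi.le]
      exact ⟨hb', by linarith, by linarith⟩
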